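/- Let $K_1$ and $K_2$ be tame knots in $S^3$, i.e. subsets of $S^3=\mathbb{R}^3\cup\{\infty\}$ that a homeomorphism of $S^3$ carries to a simple closed polygon in $\mathbb{R}^3$. For a tame knot $K\subset S^3$ let $r(K)$ denote the rank of the knot group, that is, the minimal number of elements in a generating set of $\pi_1(S^3-K)$ (for any choice of base point). Let $K_1\# K_2$ be a connected sum of $K_1$ and $K_2$ (for any choice of orientations of $K_1$ and $K_2$): a tame knot ambient isotopic to $(J_1\cap B_+)\cup(J_2\cap B_-)$, where $B_+$ and $B_-$ are two complementary closed hemispheres of $S^3$, $J_i$ is ambient isotopic to $K_i$ for $i=1,2$, and $J_1\cap B_-=C\cap B_-$, $J_2\cap B_+=C\cap B_+$ for a fixed great circle $C$ through the poles (the centers) of the hemispheres. Then $$r(K_1\# K_2)\ \ge\ \max\{r(K_1),\,r(K_2)\}.$$ -/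

import Mathlib

/-- Euclidean three-space. -/
abbrev E3 : Type := EuclideanSpace ℝ (Fin 3)

/-- The three-sphere, as the unit sphere of Euclidean four-space. -/
abbrev S3 : Type := Metric.sphere (0 : EuclideanSpace ℝ (Fin 4)) 1

/-- A closed polygon in three-space is simple if it has at least three vertices, its vertices are
distinct, and two different edges meet at most in common endpoints. -/
def IsSimplePolygon {n : ℕ} (P : Polygon E3 n) : Prop :=
  3 ≤ n ∧ Function.Injective P.vertices ∧
    ∀ i j : Fin n, i ≠ j →
      P.edgeSet ℝ i ∩ P.edgeSet ℝ j ⊆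
        {P i, P (finRotate n i)} ∩ {P j, P (finRotate n j)}

/-- A (tame, unoriented) knot in the three-sphere: a subset which some homeomorphism between
`ℝ³ ∪ {∞}` and the three-sphere identifies with a simple closed polygon in `ℝ³`. -/
structure Knot where
  carrier : Set S3
  tame : ∃ (n : ℕ) (P : Polygon E3 n) (h : OnePoint E3 ≃ₜ S3),
    IsSimplePolygon P ∧ carrier = h '' ((fun x : E3 => (x : OnePoint E3)) '' P.boundary ℝ)

/-- Two subsets of the three-sphere are ambient isotopic. -/
def AmbientIsotopic (A B : Set S3) : Prop :=
  ∃ H : unitInterval → (S3 ≃ₜ S3),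
    Continuous (fun p : unitInterval × S3 => H p.1 p.2) ∧
      H 0 = Homeomorph.refl S3 ∧ H 1 '' A = B

/-- The closed hemisphere (a closed ball) on which the last coordinate is nonnegative. -/
def upperBall : Set S3 := {x | 0 ≤ x.1 3}

/-- The closed hemisphere (a closed ball) on which the last coordinate is nonpositive. -/
def lowerBall : Set S3 := {x | x.1 3 ≤ 0}

/-- A great circle through the two poles. It meets either of the two hemispheres above in an
unknotted arc, which joins two opposite points of the common boundary sphere. -/
def greatCircle : Set S3 := {x | x.1 0 = 0 ∧ x.1 1 = 0}

/-- `K` is a connected sum of `K₁` and `K₂`: move `K₁` so that its part in the lower ball is the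
standard unknotted arc, and `K₂` so that its part in the upper ball is the standard unknotted arc;
then `K` is isotopic to the union of the remaining part of `K₁`, which lies in the upper ball, and
the remaining part of `K₂`, which lies in the lower ball. The knots are unoriented, so that this
covers the connected sum for every choice of orientations of `K₁` and `K₂`. -/
def IsConnectedSum (K K₁ K₂ : Knot) : Prop :=
  ∃ J₁ J₂ : Set S3,
    AmbientIsotopic K₁.carrier J₁ ∧ J₁ ∩ lowerBall = greatCircle ∩ lowerBall ∧
    AmbientIsotopic K₂.carrier J₂ ∧ J₂ ∩ upperBall = greatCircle ∩ upperBall ∧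
    AmbientIsotopic K.carrier ((J₁ ∩ upperBall) ∪ (J₂ ∩ lowerBall))

/-- The rank of a group: the minimal number of elements in a generating set. -/
noncomputable def minGenerators (G : Type) [Group G] : Cardinal.{0} :=
  ⨅ S : {S : Set G // Subgroup.closure S = ⊤}, Cardinal.mk S.1

/-- The complement of a knot in the three-sphere. -/
abbrev Knot.complement (K : Knot) : Type := (K.carrierᶜ : Set S3)

/-- The rank of the knot group, computed with the base point `x`. -/
noncomputable def Knot.rank (K : Knot) (x : K.complement) : Cardinal.{0} :=
  minGenerators (FundamentalGroup K.complement x)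

/-!
Let `K` be the connected sum, made of the part of `J₁` in the upper ball and the part of `J₂` in
the lower ball. The inequality `rank K₁ ≤ rank K` holds because
there are continuous maps `f : Kᶜ → J₁ᶜ` and `r : J₁ᶜ → Kᶜ` with `f ∘ r` homotopic to the
identity, so that `f` is surjective on fundamental groups; the inequality for `K₂` follows by a
reflection which exchanges the two balls.

The map `r` pushes the lower ball minus the unknotted arc radially onto the equator
(`exists_homotopic_section`). The map `f` is the identity on the upper ball, and on the lower ball
it is `y ↦ (√(1 - y₂²) G(y), y₂, 0)` in the coordinates `ℂ × ℝ × ℝ` of `ℝ⁴`, where `G : J₂ᶜ → S¹`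
is a continuous map which is the phase `z / |z|` of the first coordinate on the upper ball
(`exists_collapse`). So everything depends on the existence of `G` (`exists_phase_of_tame`): the
meridian of `J₂` has infinite order in the first homology of the complement.

To construct `G`, move `J₂` to a simple polygon in `ℝ³ ∪ {∞}` with vertices `v₀, …, vₘ`. For `x`
off the polygon let `A(x - vₖ)` be the matrix `|w| + w·σ`, `w = x - vₖ`, with `σ` the Pauli
matrices. It is a positive multiple of the projection on a line in `ℂ²`, and the lines of two
successive vertices are orthogonal only if `x` lies on the edge between them. Hence `tr (A(x - v₀)
⋯ A(x - vₘ))` does not vanish off the polygon (`CylFrame.trace_spinProd_ne_zero`); it tends to a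
positive real direction at `∞` (`CylFrame.tendsto_phase_trace_spinProd`), and near an interior
point of the edge from `vₘ` to `v₀` it is the conjugate of the complex coordinate transverse to
the edge, up to a nonvanishing factor (`CylFrame.exists_local_log`). Its phase is a map
`J₂ᶜ → S¹` of local degree `-1` at that edge.

The homeomorphism from the polygon to `J₂` is only topological, so the degree of this map around
the great circle has to be compared with its degree around the edge. Around either axis every map
to the circle is a power of the angular coordinate times `exp (i c)` with `c` real and continuous
(`exists_degree_of_retract`). If the map has degree `k` around the great circle, and the angle
around the great circle has degree `l` around the edge, then `k * l = -1`, so `k = ±1`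
(`exists_phase_mul_exp_of_tame`). The remaining factor `exp (i c)` is removed by Tietze's extension
theorem.
-/

open Set Filter Topology
open scoped unitInterval

/-! ### Maps to the circle -/

/-- A map from a convex set to the circle has a continuous logarithm. -/
theorem exists_log_of_convex {V : Type*} [NormedAddCommGroup V] [NormedSpace ℝ V] {s : Set V}
    (hs : Convex ℝ s) (hne : s.Nonempty) (g : C(s, Circle)) :
    ∃ c : C(s, ℝ), ∀ x, g x = Circle.exp (c x) := by
  have := hs.contractibleSpace hne
  have := hs.locallyPathConnectedSpace
  obtain ⟨a, ha⟩ := hne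
  obtain ⟨e₀, he₀⟩ := Circle.exp_surjective (g ⟨a, ha⟩)
  obtain ⟨F, ⟨-, hF⟩, -⟩ :=
    Circle.isCoveringMap_exp.isCoveringMapOn.existsUnique_continuousMap_lifts g he₀
      (fun _ => mem_univ _)
  exact ⟨F, fun x => (congrFun hF x).symm⟩

theorem exists_int_of_circleExp_eq_one {X : Type*} [TopologicalSpace X] [PreconnectedSpace X]
    {d : X → ℝ} (hd : Continuous d) (h : ∀ x, Circle.exp (d x) = 1) :
    ∃ k : ℤ, ∀ x, d x = k * (2 * Real.pi) := by
  rcases isEmpty_or_nonempty X with hX | ⟨⟨x₀⟩⟩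
  · exact ⟨0, fun x => hX.elim x⟩
  have hk : ∀ x, ∃ k : ℤ, d x = k * (2 * Real.pi) := fun x => by
    simpa using Circle.exp_eq_one.1 (h x)
  choose k hk using hk
  have hpi := Real.pi_pos
  have hkc : Continuous k := by
    have h1 : Continuous fun x => (k x : ℝ) := by
      have : (fun x => (k x : ℝ)) = fun x => d x / (2 * Real.pi) := by
        ext x; rw [hk x]; field_simp
      rw [this]; fun_prop
    exact Int.isClosedEmbedding_coe_real.isEmbedding.continuous_iff.2 h1
  refine ⟨k x₀, fun x => ?_⟩
  rw [hk x, PreconnectedSpace.constant ‹_› hkc (x := x) (y := x₀)]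

/-- Every map from (convex) × circle to the circle is a power of the projection times the
exponential of a real function: a logarithm of the pullback to (convex) × ℝ increases by a constant
multiple of `2π` under the deck transformation. -/
theorem exists_degree_of_convex {V : Type*} [NormedAddCommGroup V] [NormedSpace ℝ V] {s : Set V}
    (hs : Convex ℝ s) (hne : s.Nonempty) (g : C(s × Circle, Circle)) :
    ∃ (k : ℤ) (c : C(s × Circle, ℝ)), ∀ p, g p = p.2 ^ k * Circle.exp (c p) := by
  have hs' : Convex ℝ (s ×ˢ (univ : Set ℝ)) := hs.prod convex_univ
  obtain ⟨a, ha⟩ := exists_log_of_convex hs' (hne.prod univ_nonempty)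
    ⟨fun p => g (⟨p.1.1, p.2.1⟩, Circle.exp p.1.2), by fun_prop⟩
  have haux : ∀ (y : s) (t : ℝ), g (y, Circle.exp t) = Circle.exp (a ⟨(y.1, t), y.2, trivial⟩) :=
    fun y t => ha ⟨(y.1, t), y.2, trivial⟩
  have : PreconnectedSpace (s × ℝ) := by
    have := hs.contractibleSpace hne
    infer_instance
  let A : s × ℝ → ℝ := fun p => a ⟨(p.1.1, p.2), p.1.2, trivial⟩
  have hA : Continuous A := by fun_prop
  obtain ⟨k, hk⟩ := exists_int_of_circleExp_eq_one (X := s × ℝ)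
    (d := fun p => A (p.1, p.2 + 2 * Real.pi) - A p) (by fun_prop) (fun p => by
      rw [Circle.exp_sub, ← haux, ← haux, Circle.exp_add, Circle.exp_two_pi, mul_one, div_self'])
  -- Hence `A p - k * p.2` is periodic and descends to the circle.
  have hper : ∀ (p : s × ℝ) (n : ℤ),
      A (p.1, p.2 + n * (2 * Real.pi)) - k * (p.2 + n * (2 * Real.pi))
      = A p - k * p.2 := by
    intro p n
    have hp : Function.Periodic (fun t => A (p.1, t) - k * t) (2 * Real.pi) := fun t => by
      have := hk (p.1, t)
      simp only at this ⊢
      linarith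
    exact hp.int_mul n p.2
  let q : s × ℝ → s × Circle := Prod.map id Circle.exp
  have hq : IsOpenQuotientMap q :=
    IsOpenQuotientMap.id.prodMap
      ⟨Circle.exp_surjective, Circle.exp.continuous, isLocalHomeomorph_circleExp.isOpenMap⟩
  have hfac : Function.FactorsThrough (fun p : s × ℝ => A p - k * p.2) q := by
    rintro ⟨y, t⟩ ⟨y', t'⟩ h
    have hy : y = y' := congrArg Prod.fst h
    have ht : Circle.exp t = Circle.exp t' := congrArg Prod.snd h
    obtain ⟨m, rfl⟩ := Circle.exp_eq_exp.1 ht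
    subst hy
    exact hper (y, t') m
  let qc : C(s × ℝ, s × Circle) := ⟨q, hq.continuous⟩
  have hqc : IsQuotientMap qc := hq.isQuotientMap
  let c : C(s × Circle, ℝ) := hqc.lift ⟨fun p => A p - k * p.2, by fun_prop⟩ hfac
  have hc : ∀ p : s × ℝ, c (q p) = A p - k * p.2 := fun p =>
    congrArg (fun f : C(s × ℝ, ℝ) => f p) (hqc.lift_comp
      (⟨fun p => A p - k * p.2, by fun_prop⟩ : C(s × ℝ, ℝ)) hfac)
  refine ⟨k, c, fun p => ?_⟩
  obtain ⟨⟨y, t⟩, rfl⟩ := hq.surjective p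
  rw [hc, Circle.exp_sub, Circle.exp_intCast_mul]
  change g (y, Circle.exp t) = Circle.exp t ^ k * _
  rw [haux y t]
  exact (mul_div_cancel _ _).symm

/-- The conclusion of `exists_degree_of_convex` for a space that is a retract of (convex) × circle,
with angular coordinate `θ`. -/
theorem exists_degree_of_retract {X V : Type*} [TopologicalSpace X] [NormedAddCommGroup V]
    [NormedSpace ℝ V] {s : Set V} (hs : Convex ℝ s) (hne : s.Nonempty) (θ : C(X, Circle))
    (π : C(X, s)) (E : C(s × Circle, X)) (hE : ∀ x, E (π x, θ x) = x) (g : C(X, Circle)) :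
    ∃ (k : ℤ) (c : C(X, ℝ)), ∀ x, g x = θ x ^ k * Circle.exp (c x) := by
  obtain ⟨k, c, h⟩ := exists_degree_of_convex hs hne (g.comp E)
  refine ⟨k, c.comp (π.prodMk θ), fun x => ?_⟩
  simpa [hE] using h (π x, θ x)

/-- A nonzero power map of the circle has no continuous logarithm. -/
theorem eq_zero_of_zpow_eq_exp {m : ℤ} (c : C(Circle, ℝ))
    (h : ∀ u : Circle, u ^ m = Circle.exp (c u)) : m = 0 := by
  obtain ⟨k, hk⟩ := exists_int_of_circleExp_eq_one (X := ℝ)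
    (d := fun t => m * t - c (Circle.exp t)) (by fun_prop) (fun t => by
      rw [Circle.exp_sub, ← h, Circle.exp_intCast_mul, div_self'])
  have h0 := hk 0
  have h1 := hk (2 * Real.pi)
  rw [Circle.exp_zero] at h0
  rw [Circle.exp_two_pi] at h1
  have : (m : ℝ) * (2 * Real.pi) = 0 := by linarith
  have hpi := Real.pi_pos
  have : (m : ℝ) = 0 := by
    rcases mul_eq_zero.1 this with h | h
    · exact h
    · linarith
  exact_mod_cast this

/-! ### Spinor matrices and the holonomy of a polygon -/

/-- A cylindrical coordinate system on `ℝ³`: a linear isomorphism with `ℂ × ℝ` that is isometric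
for the Euclidean norm on the target. The norm of the product type is not that norm, so this is
stated separately. -/
structure CylFrame where
  toEquiv : E3 ≃L[ℝ] ℂ × ℝ
  norm_sq : ∀ w, ‖w‖ ^ 2 = ‖(toEquiv w).1‖ ^ 2 + (toEquiv w).2 ^ 2

namespace CylFrame

variable (e : CylFrame)

/-- The coordinates orthogonal to the axis, as a complex number. -/
noncomputable def planar (w : E3) : ℂ := (e.toEquiv w).1

/-- The coordinate along the axis. -/
noncomputable def axial (w : E3) : ℝ := (e.toEquiv w).2

@[fun_prop] theorem continuous_planar : Continuous e.planar := by unfold planar; fun_prop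

@[fun_prop] theorem continuous_axial : Continuous e.axial := by unfold axial; fun_prop

theorem norm_sq_eq (w : E3) : ‖w‖ ^ 2 = ‖e.planar w‖ ^ 2 + e.axial w ^ 2 := e.norm_sq w

theorem planar_sub (w v : E3) : e.planar (w - v) = e.planar w - e.planar v := by simp [planar]

theorem axial_sub (w v : E3) : e.axial (w - v) = e.axial w - e.axial v := by simp [axial]

theorem norm_sq_eq' (w : E3) :
    ‖w‖ ^ 2 = (e.planar w).re ^ 2 + (e.planar w).im ^ 2 + e.axial w ^ 2 := by
  rw [e.norm_sq_eq, ← Complex.normSq_eq_norm_sq, Complex.normSq_apply]; ring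

theorem inner_eq (w v : E3) : inner ℝ w v =
    (e.planar w).re * (e.planar v).re + (e.planar w).im * (e.planar v).im
      + e.axial w * e.axial v := by
  have h1 := norm_sub_sq_real w v
  rw [e.norm_sq_eq' w, e.norm_sq_eq' v, e.norm_sq_eq' (w - v), e.planar_sub, e.axial_sub] at h1
  simp only [Complex.sub_re, Complex.sub_im] at h1
  linarith

/-- The matrix `|w| + w·σ`, with `σ` the Pauli matrices. -/
noncomputable def spin (w : E3) : Matrix (Fin 2) (Fin 2) ℂ :=
  !![((‖w‖ + e.axial w : ℝ) : ℂ), star (e.planar w); e.planar w, ((‖w‖ - e.axial w : ℝ) : ℂ)]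

@[fun_prop] theorem continuous_spin : Continuous e.spin := by
  refine continuous_matrix fun i j => ?_
  fin_cases i <;> fin_cases j <;> simp [spin] <;> fun_prop

theorem abs_axial_le (w : E3) : |e.axial w| ≤ ‖w‖ :=
  abs_le_of_sq_le_sq (by rw [e.norm_sq_eq w]; nlinarith [sq_nonneg ‖e.planar w‖])
    (norm_nonneg w)

theorem planar_mul_star (w : E3) : e.planar w * star (e.planar w) =
    ((‖w‖ + e.axial w : ℝ) : ℂ) * ((‖w‖ - e.axial w : ℝ) : ℂ) := by
  rw [Complex.star_def, Complex.mul_conj, ← Complex.ofReal_mul, Complex.normSq_eq_norm_sq]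
  congr 1
  have := e.norm_sq_eq w
  linarith

/-- A nonzero spinor matrix is the projection on a line, up to a positive factor. -/
theorem exists_spinor (w : E3) (hw : w ≠ 0) : ∃ ψ : Fin 2 → ℂ, ψ ≠ 0 ∧
    e.spin w = Matrix.vecMulVec ψ (star ψ) := by
  have hn : 0 < ‖w‖ := norm_pos_iff.2 hw
  have ha := abs_le.1 (e.abs_axial_le w)
  have hm := e.planar_mul_star w
  rcases (by linarith : 0 ≤ ‖w‖ + e.axial w).eq_or_lt with h0 | h0
  · have hz : e.planar w = 0 := by
      rw [← h0, Complex.ofReal_zero, zero_mul] at hm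
      simpa using hm
    set r := Real.sqrt (2 * ‖w‖) with hr
    have hr0 : 0 < r := Real.sqrt_pos.2 (by positivity)
    have hrr : (r : ℂ) * r = ‖w‖ - e.axial w := by
      rw [← Complex.ofReal_mul, Real.mul_self_sqrt (by positivity), ← Complex.ofReal_sub]
      congr 1; linarith
    refine ⟨![0, (r : ℂ)], fun h => ?_, ?_⟩
    · have := congrFun h 1
      simp at this
      exact hr0.ne' this
    · ext i j
      fin_cases i <;> fin_cases j <;>
        simp [spin, Matrix.vecMulVec_apply, hz]
      · rw [← Complex.ofReal_add, ← h0]; simp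
      · rw [hrr]
  · set r := Real.sqrt (‖w‖ + e.axial w) with hr
    have hr0 : 0 < r := Real.sqrt_pos.2 h0
    have hrr : ((r : ℝ) : ℂ) * (r : ℝ) = ((‖w‖ + e.axial w : ℝ) : ℂ) := by
      rw [← Complex.ofReal_mul, Real.mul_self_sqrt h0.le]
    have hrC : ((r : ℝ) : ℂ) ≠ 0 := by exact_mod_cast hr0.ne'
    refine ⟨![(r : ℂ), e.planar w / r], fun h => ?_, ?_⟩
    · have := congrFun h 0
      simp at this
      exact hr0.ne' this
    · ext i j
      fin_cases i <;> fin_cases j <;>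
        simp [spin, Matrix.vecMulVec_apply]
      · rw [hrr]; push_cast; ring
      · field_simp
      · field_simp
      · rw [div_mul_div_comm, hrr, eq_div_iff (by rw [← hrr]; positivity)]
        have hm' := hm
        simp only [Complex.star_def] at hm'
        rw [hm']; push_cast; ring

theorem trace_spin_mul (w v : E3) :
    (e.spin w * e.spin v).trace = ((2 * (‖w‖ * ‖v‖ + inner ℝ w v) : ℝ) : ℂ) := by
  rw [e.inner_eq]
  apply Complex.ext <;>
  simp [spin, Matrix.trace_fin_two] <;> ring

/-- If `x - a` and `x - b` point in opposite directions, then `x` lies between `a` and `b`. -/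
theorem mem_segment_of_inner {x a b : E3} (h : ‖x - a‖ * ‖x - b‖ + inner ℝ (x - a) (x - b) = 0) :
    x ∈ segment ℝ a b := by
  have h1 : inner ℝ (x - a) (b - x) = ‖x - a‖ * ‖b - x‖ := by
    rw [← neg_sub x b, inner_neg_right, norm_neg]; linarith
  rw [mem_segment_iff_sameRay, sameRay_iff_norm_smul_eq]
  exact (inner_eq_norm_mul_iff_real.1 h1).symm

/-- The lines in `ℂ²` that belong to `x - a` and `x - b` are orthogonal only if `x` is on the
segment from `a` to `b`. -/
theorem dotProduct_ne_zero {x a b : E3} (h : x ∉ segment ℝ a b) {ψ φ : Fin 2 → ℂ}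
    (hψ : e.spin (x - a) = Matrix.vecMulVec ψ (star ψ))
    (hφ : e.spin (x - b) = Matrix.vecMulVec φ (star φ)) : star ψ ⬝ᵥ φ ≠ 0 := by
  intro h0
  apply h
  apply mem_segment_of_inner
  have ht := e.trace_spin_mul (x - a) (x - b)
  rw [hψ, hφ, Matrix.vecMulVec_mul_vecMulVec, h0] at ht
  simp at ht
  exact_mod_cast ht

/-- The product of the spinor matrices of `x - v 0`, …, `x - v m`, in this order. -/
noncomputable def spinProd (v : ℕ → E3) (x : E3) : ℕ → Matrix (Fin 2) (Fin 2) ℂ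
  | 0 => e.spin (x - v 0)
  | k + 1 => spinProd v x k * e.spin (x - v (k + 1))

@[fun_prop] theorem continuous_spinProd (v : ℕ → E3) (k : ℕ) :
    Continuous fun x => e.spinProd v x k := by
  induction k with
  | zero => unfold spinProd; fun_prop
  | succ k ih => unfold spinProd; fun_prop

/-- A product of rank-one matrices, none of which is killed by its neighbour, has rank one. -/
theorem spinProd_eq {v : ℕ → E3} {x : E3} {m : ℕ} (h0 : ∀ k ≤ m, x ≠ v k)
    (h : ∀ k < m, x ∉ segment ℝ (v k) (v (k + 1))) :
    ∃ (c : ℂ) (ψ φ : Fin 2 → ℂ), c ≠ 0 ∧ ψ ≠ 0 ∧ φ ≠ 0 ∧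
      e.spin (x - v 0) = Matrix.vecMulVec ψ (star ψ) ∧
      e.spin (x - v m) = Matrix.vecMulVec φ (star φ) ∧
      e.spinProd v x m = c • Matrix.vecMulVec ψ (star φ) := by
  induction m with
  | zero =>
    obtain ⟨ψ, h1, h2⟩ := e.exists_spinor (x - v 0) (sub_ne_zero.2 (h0 0 le_rfl))
    exact ⟨1, ψ, ψ, one_ne_zero, h1, h1, h2, h2, by simp [spinProd, h2]⟩
  | succ m ih =>
    obtain ⟨c, ψ, φ, hc, hψ, hφ, h1, h2, h3⟩ := ih (fun k hk => h0 k (by omega))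
      (fun k hk => h k (by omega))
    obtain ⟨χ, hχ, h4⟩ := e.exists_spinor (x - v (m + 1)) (sub_ne_zero.2 (h0 _ le_rfl))
    refine ⟨c * (star φ ⬝ᵥ χ), ψ, χ, mul_ne_zero hc
      (e.dotProduct_ne_zero (h m (by omega)) h2 h4), hψ, hχ, h1, h4, ?_⟩
    rw [spinProd, h3, h4, Matrix.smul_mul, Matrix.vecMulVec_mul_vecMulVec, Matrix.vecMulVec_smul,
      smul_smul]

theorem spinProd_ne_zero {v : ℕ → E3} {x : E3} {m : ℕ} (h0 : ∀ k ≤ m, x ≠ v k)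
    (h : ∀ k < m, x ∉ segment ℝ (v k) (v (k + 1))) : e.spinProd v x m ≠ 0 := by
  obtain ⟨c, ψ, φ, hc, hψ, hφ, h1, h2, h3⟩ := e.spinProd_eq h0 h
  rw [h3]
  refine smul_ne_zero hc ?_
  obtain ⟨i, hi⟩ := Function.ne_iff.1 hψ
  obtain ⟨j, hj⟩ := Function.ne_iff.1 hφ
  intro h
  have := congrFun (congrFun h i) j
  simp [Matrix.vecMulVec_apply] at this hi hj
  tauto

theorem trace_spinProd_ne_zero {v : ℕ → E3} {x : E3} {m : ℕ} (h0 : ∀ k ≤ m, x ≠ v k)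
    (h : ∀ k < m, x ∉ segment ℝ (v k) (v (k + 1))) (hm : x ∉ segment ℝ (v m) (v 0)) :
    (e.spinProd v x m).trace ≠ 0 := by
  obtain ⟨c, ψ, φ, hc, hψ, hφ, h1, h2, h3⟩ := e.spinProd_eq h0 h
  rw [h3, Matrix.trace_smul, Matrix.trace_vecMulVec, dotProduct_comm]
  exact smul_ne_zero hc (e.dotProduct_ne_zero hm h2 h1)

end CylFrame

/-! ### The phase of a complex number -/

/-- The phase `z / ‖z‖` of a complex number, with value `1` at `0`. -/
noncomputable def phase (z : ℂ) : Circle := Circle.exp z.arg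

theorem norm_mul_phase (z : ℂ) : (‖z‖ : ℂ) * phase z = z := by
  rw [phase, Circle.coe_exp]; exact Complex.norm_mul_exp_arg_mul_I z

theorem coe_phase {z : ℂ} (hz : z ≠ 0) : (phase z : ℂ) = z / ‖z‖ := by
  have : (‖z‖ : ℂ) ≠ 0 := by simpa using hz
  rw [eq_div_iff this, mul_comm, norm_mul_phase]

theorem phase_mul {z w : ℂ} (hz : z ≠ 0) (hw : w ≠ 0) : phase (z * w) = phase z * phase w := by
  ext
  rw [Circle.coe_mul, coe_phase (mul_ne_zero hz hw), coe_phase hz, coe_phase hw, norm_mul]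
  push_cast
  rw [div_mul_div_comm]

theorem phase_circle (u : Circle) : phase u = u := Circle.exp_arg u

theorem phase_ofReal_mul {r : ℝ} (hr : 0 < r) (z : ℂ) : phase (r * z) = phase z := by
  rw [phase, phase, Complex.arg_real_mul z hr]

theorem phase_one : phase 1 = 1 := by simp [phase]

theorem phase_star {z : ℂ} (hz : z ≠ 0) : phase (star z) = (phase z)⁻¹ := by
  have hz' : star z ≠ 0 := by simpa using hz
  rw [eq_inv_iff_mul_eq_one, ← phase_mul hz' hz, Complex.star_def, mul_comm, Complex.mul_conj,
    ← mul_one ((Complex.normSq z : ℝ) : ℂ), phase_ofReal_mul (Complex.normSq_pos.2 hz), phase_one]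

theorem continuousOn_phase : ContinuousOn phase {0}ᶜ := by
  refine Topology.IsInducing.subtypeVal.continuousOn_iff.2 ?_
  refine ContinuousOn.congr (f := fun z : ℂ => z / (‖z‖ : ℂ)) ?_ fun z hz => coe_phase hz
  refine continuousOn_id.div (by fun_prop) fun z hz => ?_
  simpa using hz

namespace CylFrame

variable (e : CylFrame)

theorem exists_spinProd_eq_spin_mul (v : ℕ → E3) (x : E3) (m : ℕ) :
    ∃ X, e.spinProd v x m = e.spin (x - v 0) * X := by
  induction m with
  | zero => exact ⟨1, by simp [spinProd]⟩
  | succ m ih =>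
    obtain ⟨X, hX⟩ := ih
    exact ⟨X * e.spin (x - v (m + 1)), by rw [spinProd, hX, mul_assoc]⟩

theorem exists_spinProd_eq_mul_spin (v : ℕ → E3) (x : E3) (m : ℕ) :
    ∃ Y, e.spinProd v x m = Y * e.spin (x - v m) := by
  cases m with
  | zero => exact ⟨1, by simp [spinProd]⟩
  | succ m => exact ⟨_, rfl⟩

/-- The second row of the product determines the first one, because this holds for the first
factor. -/
theorem spinProd_row (v : ℕ → E3) (x : E3) (m : ℕ) (j : Fin 2) :
    ((‖x - v 0‖ - e.axial (x - v 0) : ℝ) : ℂ) * e.spinProd v x m 0 j =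
      star (e.planar (x - v 0)) * e.spinProd v x m 1 j := by
  obtain ⟨X, hX⟩ := e.exists_spinProd_eq_spin_mul v x m
  have h := e.planar_mul_star (x - v 0)
  rw [hX, Matrix.mul_apply, Matrix.mul_apply, Fin.sum_univ_two, Fin.sum_univ_two]
  simp only [spin, Matrix.of_apply, Matrix.cons_val', Matrix.cons_val_zero, Matrix.cons_val_one,
    Matrix.cons_val_fin_one]
  linear_combination (-X 0 j) * h

/-- The first column of the product determines the second one, because this holds for the last
factor. -/
theorem spinProd_col (v : ℕ → E3) (x : E3) (m : ℕ) (i : Fin 2) :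
    ((‖x - v m‖ + e.axial (x - v m) : ℝ) : ℂ) * e.spinProd v x m i 1 =
      star (e.planar (x - v m)) * e.spinProd v x m i 0 := by
  obtain ⟨Y, hY⟩ := e.exists_spinProd_eq_mul_spin v x m
  have h := e.planar_mul_star (x - v m)
  rw [hY, Matrix.mul_apply, Matrix.mul_apply, Fin.sum_univ_two, Fin.sum_univ_two]
  simp only [spin, Matrix.of_apply, Matrix.cons_val', Matrix.cons_val_zero, Matrix.cons_val_one,
    Matrix.cons_val_fin_one]
  linear_combination (-Y i 1) * h

/-- If the edge from `v m` to `v 0` is parallel to the axis and `x` is at a height strictly between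
its endpoints, then the trace is a positive multiple of the conjugate transverse coordinate times a
matrix entry. That entry does not vanish on the edge, by `spinProd_one_zero_ne_zero`. -/
theorem trace_spinProd_eq {v : ℕ → E3} {x : E3} {m : ℕ} (hv : e.planar (v m) = e.planar (v 0))
    (h0 : e.axial x < e.axial (v 0)) (hm : e.axial (v m) < e.axial x) :
    ∃ r : ℝ, 0 < r ∧ (e.spinProd v x m).trace =
      r * (star (e.planar (x - v 0)) * e.spinProd v x m 1 0) := by
  have h1 := e.spinProd_row v x m 0
  have h2 := e.spinProd_col v x m 1
  have hv' : e.planar (x - v m) = e.planar (x - v 0) := by rw [planar_sub, planar_sub, hv]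
  rw [hv'] at h2
  set d0 := ‖x - v 0‖ - e.axial (x - v 0)
  set dm := ‖x - v m‖ + e.axial (x - v m)
  have hd0 : 0 < d0 := by
    have : e.axial (x - v 0) < 0 := by rw [axial_sub]; linarith
    have := norm_nonneg (x - v 0)
    simp only [d0]; linarith
  have hdm : 0 < dm := by
    have : 0 < e.axial (x - v m) := by rw [axial_sub]; linarith
    have := norm_nonneg (x - v m)
    simp only [dm]; linarith
  refine ⟨1 / d0 + 1 / dm, by positivity, ?_⟩
  have hd0' : (d0 : ℂ) ≠ 0 := by exact_mod_cast hd0.ne'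
  have hdm' : (dm : ℂ) ≠ 0 := by exact_mod_cast hdm.ne'
  rw [Matrix.trace_fin_two]
  push_cast
  field_simp
  linear_combination (dm : ℂ) * h1 + (d0 : ℂ) * h2

theorem spinProd_one_zero_ne_zero {v : ℕ → E3} {q : E3} {m : ℕ}
    (hv0 : e.planar (v 0) = e.planar q) (hvm : e.planar (v m) = e.planar q)
    (h0 : e.axial q < e.axial (v 0)) (hm : e.axial (v m) < e.axial q)
    (hne : e.spinProd v q m ≠ 0) : e.spinProd v q m 1 0 ≠ 0 := by
  intro h10
  have hrow := e.spinProd_row v q m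
  have hcol := e.spinProd_col v q m
  have hz0 : e.planar (q - v 0) = 0 := by rw [planar_sub, hv0, sub_self]
  have hzm : e.planar (q - v m) = 0 := by rw [planar_sub, hvm, sub_self]
  simp only [hz0, hzm, star_zero, zero_mul, mul_eq_zero, Complex.ofReal_eq_zero] at hrow hcol
  have hd0 : ‖q - v 0‖ - e.axial (q - v 0) ≠ 0 := by
    have : e.axial (q - v 0) < 0 := by rw [axial_sub]; linarith
    have := norm_nonneg (q - v 0)
    intro h; linarith
  have hdm : ‖q - v m‖ + e.axial (q - v m) ≠ 0 := by
    have : 0 < e.axial (q - v m) := by rw [axial_sub]; linarith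
    have := norm_nonneg (q - v m)
    intro h; linarith
  apply hne
  ext i j
  fin_cases i
  · exact (hrow j).resolve_left hd0
  · fin_cases j
    · exact h10
    · exact (hcol 1).resolve_left hdm

/-- Near an interior point `q` of the edge from `v m` to `v 0`, the phase of the trace is inverse to
the angle around that edge, up to the exponential of a real function. -/
theorem exists_local_log {v : ℕ → E3} {q : E3} {m : ℕ}
    (hv0 : e.planar (v 0) = e.planar q) (hvm : e.planar (v m) = e.planar q)
    (h0 : e.axial q < e.axial (v 0)) (hm : e.axial (v m) < e.axial q)
    (hne : e.spinProd v q m ≠ 0) :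
    ∃ (U : Set E3) (c : E3 → ℝ), U ∈ 𝓝 q ∧ ContinuousOn c U ∧ ∀ x ∈ U, e.planar (x - q) ≠ 0 →
      phase (e.spinProd v x m).trace = (phase (e.planar (x - q)))⁻¹ * Circle.exp (c x) := by
  have hn := e.spinProd_one_zero_ne_zero hv0 hvm h0 hm hne
  set g : E3 → ℂ := fun x => e.spinProd v x m 1 0 with hg
  have hgc : Continuous g := (e.continuous_spinProd v m).matrix_elem 1 0
  let U : Set E3 := {x | e.axial x < e.axial (v 0)} ∩ {x | e.axial (v m) < e.axial x} ∩
    {x | g x / g q ∈ Complex.slitPlane}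
  have hU : IsOpen U := by
    refine ((isOpen_lt (by fun_prop) (by fun_prop)).inter
      (isOpen_lt (by fun_prop) (by fun_prop))).inter ?_
    exact Complex.isOpen_slitPlane.preimage (by fun_prop)
  have hqU : q ∈ U := ⟨⟨h0, hm⟩, by
    rw [mem_ofPred, div_self hn]; exact Complex.one_mem_slitPlane⟩
  refine ⟨U, fun x => (g x / g q).arg + (g q).arg, hU.mem_nhds hqU, ?_, ?_⟩
  · refine ContinuousOn.add ?_ continuousOn_const
    intro x hx
    exact ((Complex.continuousAt_arg hx.2).comp
      (f := fun x => g x / g q) (by fun_prop)).continuousWithinAt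
  · rintro x ⟨⟨hx0, hxm⟩, hx⟩ hz
    obtain ⟨r, hr, htr⟩ := e.trace_spinProd_eq (hvm.trans hv0.symm) hx0 hxm
    have hgx : g x ≠ 0 := by
      intro h
      rw [mem_ofPred, h, zero_div] at hx
      simp at hx
    have hz' : e.planar (x - v 0) = e.planar (x - q) := by rw [planar_sub, planar_sub, hv0]
    have hzs : star (e.planar (x - q)) ≠ 0 := by simpa using hz
    rw [htr, phase_ofReal_mul hr, hz', phase_mul hzs hgx, phase_star hz]
    congr 1
    rw [Circle.exp_add]
    change _ = phase _ * phase _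
    rw [← phase_mul (div_ne_zero hgx hn) hn, div_mul_cancel₀ _ hn]

/-! ### Behaviour at infinity -/

theorem planar_smul (s : ℝ) (w : E3) : e.planar (s • w) = s * e.planar w := by simp [planar]

theorem axial_smul (s : ℝ) (w : E3) : e.axial (s • w) = s * e.axial w := by simp [axial]

theorem spin_smul {s : ℝ} (hs : 0 ≤ s) (w : E3) : e.spin (s • w) = (s : ℂ) • e.spin w := by
  ext i j
  fin_cases i <;> fin_cases j <;>
    simp [spin, planar_smul, axial_smul, norm_smul, abs_of_nonneg hs] <;> ring

theorem spin_mul_self (w : E3) : e.spin w * e.spin w = ((2 * ‖w‖ : ℝ) : ℂ) • e.spin w := by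
  have h := e.planar_mul_star w
  simp only [Complex.star_def, Complex.ofReal_add, Complex.ofReal_sub] at h
  ext i j
  fin_cases i <;> fin_cases j <;>
    simp [spin, Matrix.mul_apply, Fin.sum_univ_two]
  · linear_combination h
  · ring
  · ring
  · linear_combination h

theorem spinProd_zero (u : E3) (m : ℕ) :
    e.spinProd 0 u m = ((2 * ‖u‖ : ℝ) : ℂ) ^ m • e.spin u := by
  induction m with
  | zero => simp [spinProd]
  | succ m ih =>
    rw [spinProd, ih, Pi.zero_apply, sub_zero, Matrix.smul_mul, spin_mul_self, smul_smul, pow_succ]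

theorem spinProd_smul {s : ℝ} (hs : 0 ≤ s) (v : ℕ → E3) (x : E3) (m : ℕ) :
    e.spinProd (s • v) (s • x) m = (s : ℂ) ^ (m + 1) • e.spinProd v x m := by
  induction m with
  | zero => simp [spinProd, ← smul_sub, e.spin_smul hs]
  | succ m ih =>
    rw [spinProd, ih, Pi.smul_apply, ← smul_sub, e.spin_smul hs, Matrix.smul_mul, Matrix.mul_smul,
      smul_smul, ← pow_succ, spinProd]

theorem continuous_spinProd_smul (v : ℕ → E3) (m : ℕ) :
    Continuous fun p : ℝ × E3 => e.spinProd (p.1 • v) p.2 m := by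
  induction m with
  | zero => simp only [spinProd, Pi.smul_apply]; fun_prop
  | succ m ih => simp only [spinProd, Pi.smul_apply]; fun_prop

/-- Rescaling by `‖x‖⁻¹` moves all vertices to the origin as `x` tends to infinity, and for vertices
at the origin the trace is positive. -/
theorem tendsto_phase_trace_spinProd (v : ℕ → E3) (m : ℕ) :
    Tendsto (fun x => phase (e.spinProd v x m).trace) (cocompact E3) (𝓝 1) := by
  have hcont : ∀ u ∈ Metric.sphere (0 : E3) 1,
      Tendsto (fun p : ℝ × E3 => phase (e.spinProd (p.1 • v) p.2 m).trace) (𝓝 (0, u)) (𝓝 1) := by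
    intro u hu
    have hu' : ‖u‖ = 1 := by simpa using hu
    have h0 : (e.spinProd ((0 : ℝ) • v) u m).trace = ((2 ^ (m + 1) : ℝ) : ℂ) := by
      rw [zero_smul, spinProd_zero, Matrix.trace_smul, Matrix.trace_fin_two, hu']
      simp [spin, hu', pow_succ]
      norm_num
    have hc := (e.continuous_spinProd_smul v m).matrix_trace.continuousAt (x := (0, u))
    have hne : (e.spinProd ((0 : ℝ) • v) u m).trace ≠ 0 := by
      rw [h0]; exact Complex.ofReal_ne_zero.2 (by positivity)
    have hp : ContinuousAt phase (e.spinProd ((0 : ℝ) • v) u m).trace :=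
      continuousOn_phase.continuousAt (isOpen_compl_singleton.mem_nhds hne)
    have := Tendsto.comp (g := phase) hp hc
    have h1 : phase (e.spinProd ((0 : ℝ) • v) u m).trace = 1 := by
      rw [h0, ← mul_one ((2 ^ (m + 1) : ℝ) : ℂ), phase_ofReal_mul (by positivity), phase_one]
    rwa [h1] at this
  rw [tendsto_def]
  intro W hW
  have hW' : ∀ᶠ s : ℝ in 𝓝 0, ∀ u ∈ Metric.sphere (0 : E3) 1,
      phase (e.spinProd (s • v) u m).trace ∈ W :=
    (isCompact_sphere (0 : E3) 1).eventually_forall_of_forall_eventually fun u hu =>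
      (hcont u hu).eventually_mem hW
  have hinv : Tendsto (fun x : E3 => ‖x‖⁻¹) (cocompact E3) (𝓝 0) :=
    tendsto_inv_atTop_zero.comp (tendsto_norm_cocompact_atTop (E := E3))
  have hpos : ∀ᶠ x : E3 in cocompact E3, 0 < ‖x‖ :=
    (tendsto_norm_cocompact_atTop (E := E3)).eventually_gt_atTop 0
  filter_upwards [hinv.eventually hW', hpos] with x hx hx0
  have := hx (‖x‖⁻¹ • x) (by simp [norm_smul, hx0.ne'])
  rwa [spinProd_smul _ (by positivity), Matrix.trace_smul, smul_eq_mul, ← Complex.ofReal_pow,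
    phase_ofReal_mul (by positivity)] at this

end CylFrame

/-! ### The phase function of a simple polygon -/

namespace CylFrame

/-- Every nondegenerate segment is parallel to the axis of some cylindrical coordinate system. -/
theorem exists_axial (a b : E3) (hab : a ≠ b) : ∃ e : CylFrame, e.planar a = e.planar b ∧
    e.axial a < e.axial b := by
  have hn : 0 < ‖b - a‖ := norm_pos_iff.2 (sub_ne_zero.2 hab.symm)
  let w : Fin 3 → E3 := fun _ => ‖b - a‖⁻¹ • (b - a)
  have hw : Orthonormal ℝ (({2} : Set (Fin 3)).domRestrict w) := by
    constructor
    · intro i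
      change ‖‖b - a‖⁻¹ • (b - a)‖ = 1
      simp [norm_smul, hn.ne']
    · intro i j hij; exact absurd (Subsingleton.elim i j) hij
  obtain ⟨B, hB⟩ := hw.exists_orthonormalBasis_extension_of_card_eq (by simp)
  have hB2 : B 2 = ‖b - a‖⁻¹ • (b - a) := hB 2 rfl
  let T : E3 ≃ₗ[ℝ] ℂ × ℝ :=
    { toFun := fun x => (⟨B.repr x 0, B.repr x 1⟩, B.repr x 2)
      invFun := fun p => B.repr.symm !₂[p.1.re, p.1.im, p.2]
      map_add' := fun x y => by simp [Complex.ext_iff]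
      map_smul' := fun r x => by simp [Complex.ext_iff]
      left_inv := fun x => by
        apply B.repr.injective
        ext i
        fin_cases i <;> simp
      right_inv := fun p => by simp }
  have hT : ∀ x, T x = (⟨B.repr x 0, B.repr x 1⟩, B.repr x 2) := fun x => rfl
  let e : CylFrame := ⟨T.toContinuousLinearEquiv, fun x => by
    rw [← B.repr.norm_map x, EuclideanSpace.norm_sq_eq, Fin.sum_univ_three]
    simp [hT, ← Complex.normSq_eq_norm_sq, Complex.normSq_apply]
    ring⟩
  have hba : b - a = ‖b - a‖ • B 2 := by rw [hB2, smul_smul, mul_inv_cancel₀ hn.ne', one_smul]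
  have hpl : e.planar (b - a) = 0 := by
    rw [hba, planar_smul]
    simp [planar, e, hT, Complex.ext_iff]
  have hax : e.axial (b - a) = ‖b - a‖ := by
    rw [hba, axial_smul, norm_smul]
    simp [axial, e, hT]
  refine ⟨e, ?_, ?_⟩
  · rw [planar_sub] at hpl; exact (sub_eq_zero.1 hpl).symm
  · rw [axial_sub] at hax; linarith

variable (e : CylFrame)

theorem planar_add_smul (a d : E3) (s : ℝ) :
    e.planar (a + s • d) = e.planar a + s * e.planar d := by simp [planar]

theorem axial_add_smul (a d : E3) (s : ℝ) :
    e.axial (a + s • d) = e.axial a + s * e.axial d := by simp [axial]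

theorem ext {x y : E3} (h1 : e.planar x = e.planar y) (h2 : e.axial x = e.axial y) : x = y :=
  e.toEquiv.injective (Prod.ext h1 h2)

end CylFrame

open Fin.NatCast Fin.CommRing in
/-- The vertices of a simple polygon, numbered from the end of an edge that contains the given
point `q` in its interior. No other edge contains `q`. -/
theorem IsSimplePolygon.exists_vertices {n : ℕ} {P : Polygon E3 n} (hP : IsSimplePolygon P) {q : E3}
    (hq : q ∈ P.boundary ℝ) (hqv : q ∉ range P.vertices) :
    ∃ (m : ℕ) (v : ℕ → E3), v m ≠ v 0 ∧
      P.boundary ℝ = (⋃ k ∈ Iio m, segment ℝ (v k) (v (k + 1))) ∪ segment ℝ (v m) (v 0) ∧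
      q ∈ openSegment ℝ (v m) (v 0) ∧ (∀ k ≤ m, q ≠ v k) ∧
      ∀ k < m, q ∉ segment ℝ (v k) (v (k + 1)) := by
  obtain ⟨hn, hinj, hedge⟩ := hP
  obtain ⟨i, hi⟩ := mem_iUnion.1 hq
  obtain ⟨m, rfl⟩ : ∃ m, n = m + 1 := ⟨n - 1, by omega⟩
  have hedgeSet : ∀ j : Fin (m + 1), P.edgeSet ℝ j =
      segment ℝ (P.vertices j) (P.vertices (j + 1)) := by
    intro j
    rw [Polygon.edgeSet, affineSegment_eq_segment, finRotate_apply]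
  let v : ℕ → E3 := fun k => P.vertices (i + 1 + (k : Fin (m + 1)))
  have hv0 : v 0 = P.vertices (i + 1) := by simp [v]
  have hm0 : ((m : Fin (m + 1)) + 1) = 0 := by
    have := Fin.natCast_self (m + 1); push_cast at this; exact this
  have hvm : v m = P.vertices i := by
    simp only [v]; rw [add_assoc, add_comm 1, hm0, add_zero]
  have hvk : ∀ k, segment ℝ (v k) (v (k + 1)) = P.edgeSet ℝ (i + 1 + (k : Fin (m + 1))) := by
    intro k; rw [hedgeSet]; simp only [v]; push_cast; rw [add_assoc (i + 1)]
  have hvclose : segment ℝ (v m) (v 0) = P.edgeSet ℝ i := by rw [hedgeSet, hv0, hvm]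
  have hi1 : i + 1 ≠ i := by
    intro h
    have : (1 : Fin (m + 1)) = 0 := by simpa using h
    have := congrArg Fin.val this
    rw [Fin.val_one', Nat.mod_eq_of_lt (by omega)] at this
    simp at this
  have hqv' : ∀ k, q ≠ v k := fun k h => hqv ⟨_, h.symm⟩
  refine ⟨m, v, ?_, ?_, ?_, fun k _ => hqv' k, ?_⟩
  · rw [hv0, hvm]; exact fun h => hi1 (hinj h).symm
  · apply Subset.antisymm
    · refine iUnion_subset fun j => ?_
      set k := (j - (i + 1)).val with hk
      have hkj : i + 1 + (k : Fin (m + 1)) = j := by rw [hk, Fin.cast_val_eq_self]; abel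
      rcases (show k ≤ m by omega).lt_or_eq with h | h
      · refine Subset.trans ?_ subset_union_left
        rw [← hkj, ← hvk k]
        exact subset_biUnion_of_mem (u := fun k => segment ℝ (v k) (v (k + 1))) h
      · refine Subset.trans ?_ subset_union_right
        rw [hvclose, ← hkj, h, add_assoc, add_comm 1, hm0, add_zero]
    · refine union_subset (iUnion₂_subset fun k _ => ?_) ?_
      · rw [hvk]; exact subset_iUnion (fun j => P.edgeSet ℝ j) _
      · rw [hvclose]; exact subset_iUnion (fun j => P.edgeSet ℝ j) _
  · rw [← hvclose, ← insert_endpoints_openSegment] at hi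
    rcases hi with h | h | h
    · exact absurd h (hqv' m)
    · exact absurd h (hqv' 0)
    · exact h
  · intro k hk hqk
    rw [hvk] at hqk
    have hne : i ≠ i + 1 + (k : Fin (m + 1)) := by
      intro h
      have h1 : (1 : Fin (m + 1)) + k = 0 := by rw [add_assoc] at h; simpa using h.symm
      have h2 : ((k + 1 : ℕ) : Fin (m + 1)) = 0 := by push_cast; exact (add_comm _ _).trans h1
      rw [Fin.natCast_eq_zero] at h2
      exact absurd (Nat.le_of_dvd (by omega) h2) (by omega)
    have := (hedge _ _ hne ⟨hi, hqk⟩).1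
    rcases this with h | h
    · exact hqv ⟨_, h.symm⟩
    · exact hqv ⟨_, h.symm⟩

/-- A map to the circle from the complement of a simple polygon in `ℝ³ ∪ {∞}` which, near a given
point `q` inside an edge, is inverse to the angle around that edge up to the exponential of a real
function. -/
theorem IsSimplePolygon.exists_phase {n : ℕ} {P : Polygon E3 n} (hP : IsSimplePolygon P) {q : E3}
    (hq : q ∈ P.boundary ℝ) (hqv : q ∉ range P.vertices) :
    ∃ (e : CylFrame) (G : OnePoint E3 → Circle) (U : Set E3) (c : E3 → ℝ),
      ContinuousOn G ((fun x : E3 => (x : OnePoint E3)) '' P.boundary ℝ)ᶜ ∧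
      U ∈ 𝓝 q ∧ ContinuousOn c U ∧ (∀ x ∈ U, x ∈ P.boundary ℝ ↔ e.planar (x - q) = 0) ∧
      ∀ x ∈ U, e.planar (x - q) ≠ 0 →
        G x = (phase (e.planar (x - q)))⁻¹ * Circle.exp (c x) := by
  obtain ⟨m, v, hv, hbd, hqo, hqk, hqe⟩ := hP.exists_vertices hq hqv
  obtain ⟨e, he1, he2⟩ := CylFrame.exists_axial (v m) (v 0) hv
  rw [openSegment_eq_image'] at hqo
  obtain ⟨s, ⟨hs0, hs1⟩, hsq⟩ := hqo
  simp only at hsq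
  have hpl0 : e.planar (v 0 - v m) = 0 := by rw [e.planar_sub, he1, sub_self]
  have hax0 : e.axial (v 0 - v m) = e.axial (v 0) - e.axial (v m) := e.axial_sub _ _
  have hqp : e.planar (v m) = e.planar q := by
    rw [← hsq, e.planar_add_smul, hpl0, mul_zero, add_zero]
  have hqa : e.axial q = e.axial (v m) + s * (e.axial (v 0) - e.axial (v m)) := by
    rw [← hsq, e.axial_add_smul, hax0]
  have hqm : e.axial (v m) < e.axial q := by
    rw [hqa]; have := mul_pos hs0 (sub_pos.2 he2); linarith
  have hq0 : e.axial q < e.axial (v 0) := by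
    rw [hqa]; have := mul_pos (sub_pos.2 hs1) (sub_pos.2 he2); linarith
  obtain ⟨U, c, hU, hc, hUc⟩ := e.exists_local_log (v := v) (m := m)
    (he1.symm.trans hqp) hqp hq0 hqm (e.spinProd_ne_zero hqk hqe)
  let W : Set E3 := {x | e.axial x < e.axial (v 0)} ∩ {x | e.axial (v m) < e.axial x} ∩
    (⋃ k ∈ Iio m, segment ℝ (v k) (v (k + 1)))ᶜ
  have hW : W ∈ 𝓝 q := by
    refine IsOpen.mem_nhds ?_ ⟨⟨hq0, hqm⟩, ?_⟩
    · refine ((isOpen_lt (by fun_prop) (by fun_prop)).inter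
        (isOpen_lt (by fun_prop) (by fun_prop))).inter ?_
      refine ((finite_Iio m).isClosed_biUnion fun k _ => ?_).isOpen_compl
      rw [← convexHull_pair]
      exact ((Set.toFinite _).isCompact_convexHull (𝕜 := ℝ)).isClosed
    · simpa using hqe
  have hvert : ∀ x ∉ P.boundary ℝ, ∀ k ≤ m, x ≠ v k := by
    rintro x hx k hk rfl
    apply hx
    rw [hbd]
    rcases hk.lt_or_eq with h | rfl
    · exact Or.inl (mem_biUnion (show k ∈ Iio m from h) (left_mem_segment _ _ _))
    · exact Or.inr (left_mem_segment _ _ _)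
  let G : OnePoint E3 → Circle := fun x =>
    OnePoint.elim x 1 (fun x : E3 => phase (e.spinProd v x m).trace)
  refine ⟨e, G, U ∩ W, c, ?_, inter_mem hU hW, hc.mono inter_subset_left, ?_, ?_⟩
  · intro x hx
    apply ContinuousAt.continuousWithinAt
    induction x using OnePoint.rec with
    | infty =>
      rw [OnePoint.continuousAt_infty', coclosedCompact_eq_cocompact]
      exact e.tendsto_phase_trace_spinProd v m
    | coe x =>
      have hx' : x ∉ P.boundary ℝ := fun h => hx ⟨x, h, rfl⟩
      rw [OnePoint.continuousAt_coe]
      have hne : (e.spinProd v x m).trace ≠ 0 := by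
        refine e.trace_spinProd_ne_zero (hvert x hx') ?_ ?_
        · intro k hk h
          exact hx' (hbd ▸ Or.inl (mem_biUnion (show k ∈ Iio m from hk) h))
        · intro h
          exact hx' (hbd ▸ Or.inr h)
      exact (continuousOn_phase.continuousAt (isOpen_compl_singleton.mem_nhds hne)).comp
        (f := fun x => (e.spinProd v x m).trace)
        (e.continuous_spinProd v m).matrix_trace.continuousAt
  · rintro x ⟨-, ⟨hx0, hxm⟩, hxk⟩
    rw [hbd, mem_union, or_iff_right hxk, e.planar_sub, sub_eq_zero, segment_eq_image']
    constructor
    · rintro ⟨t, -, rfl⟩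
      rw [e.planar_add_smul, hpl0, mul_zero, add_zero, hqp]
    · intro h
      have hd : 0 < e.axial (v 0) - e.axial (v m) := sub_pos.2 he2
      simp only [mem_ofPred] at hx0 hxm
      refine ⟨(e.axial x - e.axial (v m)) / (e.axial (v 0) - e.axial (v m)), ⟨?_, ?_⟩, ?_⟩
      · exact div_nonneg (by linarith) hd.le
      · rw [div_le_one hd]; linarith
      · refine e.ext ?_ ?_
        · rw [e.planar_add_smul, hpl0, mul_zero, add_zero, hqp, h]
        · rw [e.axial_add_smul, hax0, div_mul_cancel₀ _ hd.ne']; ring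
  · rintro x ⟨hx, -⟩ hz
    exact hUc x hx hz

/-! ### Degrees of circle-valued maps around an axis -/

namespace CylFrame

variable (e : CylFrame)

theorem exists_degree (q : E3) {ε : ℝ} (hε : 0 < ε)
    (g : C({x : E3 // x ∈ Metric.ball q ε ∧ e.planar (x - q) ≠ 0}, Circle)) :
    ∃ (k : ℤ) (c : C({x : E3 // x ∈ Metric.ball q ε ∧ e.planar (x - q) ≠ 0}, ℝ)),
      ∀ x, g x = phase (e.planar (x.1 - q)) ^ k * Circle.exp (c x) := by
  let s : Set ℂ := {z | 0 < z.re} ∩ Metric.ball 0 ε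
  have hs : Convex ℝ s := (convex_halfSpace_re_gt 0).inter (convex_ball _ _)
  have hne : s.Nonempty := ⟨((ε / 2 : ℝ) : ℂ), by
    simp only [mem_ofPred, Complex.ofReal_re]; positivity, by
    simp [abs_of_pos hε]; linarith⟩
  have hnorm : ∀ (z : ℂ) (u : Circle), ‖e.toEquiv.symm ((z.re : ℂ) * u, z.im)‖ = ‖z‖ := by
    intro z u
    rw [← sq_eq_sq₀ (norm_nonneg _) (norm_nonneg _), e.norm_sq, e.toEquiv.apply_symm_apply,
      norm_mul, Circle.norm_coe, mul_one, Complex.norm_real, Real.norm_eq_abs, sq_abs,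
      ← Complex.normSq_eq_norm_sq, Complex.normSq_apply]
    ring
  have hpl : ∀ (z : ℂ) (u : Circle),
      e.planar (q + e.toEquiv.symm ((z.re : ℂ) * u, z.im) - q) = (z.re : ℂ) * u := by
    intro z u; simp [planar]
  let θ : C({x : E3 // x ∈ Metric.ball q ε ∧ e.planar (x - q) ≠ 0}, Circle) :=
    ⟨fun x => phase (e.planar (x.1 - q)),
      continuousOn_phase.comp_continuous (by fun_prop) fun x => x.2.2⟩
  let E : C(s × Circle, {x : E3 // x ∈ Metric.ball q ε ∧ e.planar (x - q) ≠ 0}) :=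
    ⟨fun p => ⟨q + e.toEquiv.symm ((p.1.1.re : ℂ) * p.2, p.1.1.im), by
      obtain ⟨⟨z, hz1, hz2⟩, u⟩ := p
      refine ⟨?_, ?_⟩
      · simpa [hnorm] using hz2
      · rw [hpl]
        refine mul_ne_zero (Complex.ofReal_ne_zero.2 (ne_of_gt hz1)) u.coe_ne_zero⟩, by fun_prop⟩
  let π : C({x : E3 // x ∈ Metric.ball q ε ∧ e.planar (x - q) ≠ 0}, s) :=
    ⟨fun x => ⟨⟨‖e.planar (x.1 - q)‖, e.axial (x.1 - q)⟩, norm_pos_iff.2 x.2.2, by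
      have h := x.2.1
      rw [mem_ball_iff_norm] at h
      rw [mem_ball_zero_iff]
      refine lt_of_le_of_lt (le_of_eq ?_) h
      rw [← sq_eq_sq₀ (norm_nonneg _) (norm_nonneg _), e.norm_sq_eq, ← Complex.normSq_eq_norm_sq,
        Complex.normSq_apply]
      simp only
      ring⟩, by
      refine Continuous.subtype_mk ?_ _
      have : (fun x : {x : E3 // x ∈ Metric.ball q ε ∧ e.planar (x - q) ≠ 0} =>
          (⟨‖e.planar (x.1 - q)‖, e.axial (x.1 - q)⟩ : ℂ)) =
          fun x => (‖e.planar (x.1 - q)‖ : ℂ) + (e.axial (x.1 - q) : ℂ) * Complex.I := by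
        ext x
        exact Complex.mk_eq_add_mul_I _ _
      rw [this]
      fun_prop⟩
  refine exists_degree_of_retract hs hne θ π E (fun x => Subtype.ext ?_) g
  change q + e.toEquiv.symm ((‖e.planar (x.1 - q)‖ : ℂ) * phase (e.planar (x.1 - q)),
    e.axial (x.1 - q)) = x.1
  rw [norm_mul_phase]
  have : (e.planar (x.1 - q), e.axial (x.1 - q)) = e.toEquiv (x.1 - q) := rfl
  rw [this, e.toEquiv.symm_apply_apply, add_sub_cancel]

theorem eq_zero_of_phase_zpow_eq_exp (q : E3) {ε : ℝ} (hε : 0 < ε) {m : ℤ}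
    (c : C({x : E3 // x ∈ Metric.ball q ε ∧ e.planar (x - q) ≠ 0}, ℝ))
    (h : ∀ x, phase (e.planar (x.1 - q)) ^ m = Circle.exp (c x)) : m = 0 := by
  have hpl : ∀ u : Circle,
      e.planar (q + e.toEquiv.symm (((ε / 2 : ℝ) : ℂ) * u, 0) - q) = ((ε / 2 : ℝ) : ℂ) * u := by
    intro u; simp [planar]
  let L : C(Circle, {x : E3 // x ∈ Metric.ball q ε ∧ e.planar (x - q) ≠ 0}) :=
    ⟨fun u => ⟨q + e.toEquiv.symm (((ε / 2 : ℝ) : ℂ) * u, 0), by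
      refine ⟨?_, ?_⟩
      · rw [mem_ball_iff_norm, add_sub_cancel_left]
        refine lt_of_le_of_lt (le_of_eq ?_) (half_lt_self hε)
        rw [← sq_eq_sq₀ (norm_nonneg _) (by positivity), e.norm_sq,
          e.toEquiv.apply_symm_apply, norm_mul, Circle.norm_coe, mul_one, Complex.norm_real,
          Real.norm_eq_abs, sq_abs]
        ring
      · rw [hpl]
        exact mul_ne_zero (Complex.ofReal_ne_zero.2 (by positivity)) u.coe_ne_zero⟩, by fun_prop⟩
  refine eq_zero_of_zpow_eq_exp (c.comp L) fun u => ?_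
  rw [ContinuousMap.comp_apply, ← h (L u)]
  change _ = phase (e.planar (q + e.toEquiv.symm (((ε / 2 : ℝ) : ℂ) * u, 0) - q)) ^ m
  rw [hpl, phase_ofReal_mul (by positivity), phase_circle]

end CylFrame

/-! ### Coordinates on the three-sphere -/

namespace S3

/-- The first two coordinates of a point of the three-sphere, as a complex number. -/
def planar (y : S3) : ℂ := ⟨y.1 0, y.1 1⟩

@[fun_prop] theorem continuous_planar : Continuous planar := by
  have : planar = fun y : S3 => (y.1 0 : ℂ) + (y.1 1 : ℂ) * Complex.I := by
    ext y; exact Complex.mk_eq_add_mul_I _ _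
  rw [this]; fun_prop

theorem norm_sq_planar_add (y : S3) : ‖planar y‖ ^ 2 + y.1 2 ^ 2 + y.1 3 ^ 2 = 1 := by
  have h : ‖y.1‖ = 1 := by simp
  have h2 : ‖y.1‖ ^ 2 = 1 := by rw [h]; norm_num
  rw [EuclideanSpace.norm_sq_eq, Fin.sum_univ_four] at h2
  simp only [Real.norm_eq_abs, sq_abs] at h2
  rw [← Complex.normSq_eq_norm_sq, Complex.normSq_apply]
  simp only [planar]
  linarith

theorem mem_greatCircle {y : S3} : y ∈ greatCircle ↔ planar y = 0 := by
  simp [greatCircle, planar, Complex.ext_iff]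

theorem sq_le_one (y : S3) : y.1 2 ^ 2 ≤ 1 := by
  have := norm_sq_planar_add y
  nlinarith [sq_nonneg ‖planar y‖, sq_nonneg (y.1 3)]

/-- The point of the three-sphere with given coordinates. -/
def mk (z : ℂ) (a b : ℝ) (h : ‖z‖ ^ 2 + a ^ 2 + b ^ 2 = 1) : S3 :=
  ⟨!₂[z.re, z.im, a, b], by
    rw [mem_sphere_zero_iff_norm, ← sq_eq_sq₀ (norm_nonneg _) zero_le_one,
      EuclideanSpace.norm_sq_eq, Fin.sum_univ_four]
    rw [← Complex.normSq_eq_norm_sq, Complex.normSq_apply] at h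
    simp
    linarith⟩

@[simp] theorem planar_mk {z : ℂ} {a b : ℝ} (h : ‖z‖ ^ 2 + a ^ 2 + b ^ 2 = 1) :
    planar (mk z a b h) = z := by simp [planar, mk]

@[simp] theorem mk_two {z : ℂ} {a b : ℝ} (h : ‖z‖ ^ 2 + a ^ 2 + b ^ 2 = 1) :
    (mk z a b h).1 2 = a := by simp [mk]

@[simp] theorem mk_three {z : ℂ} {a b : ℝ} (h : ‖z‖ ^ 2 + a ^ 2 + b ^ 2 = 1) :
    (mk z a b h).1 3 = b := by simp [mk]

theorem ext' {x y : S3} (h1 : planar x = planar y) (h2 : x.1 2 = y.1 2) (h3 : x.1 3 = y.1 3) :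
    x = y := by
  rw [Complex.ext_iff] at h1
  refine Subtype.ext ?_
  ext i
  fin_cases i
  exacts [h1.1, h1.2, h2, h3]

theorem continuous_mk {X : Type*} [TopologicalSpace X] {z : X → ℂ} {a b : X → ℝ}
    (h : ∀ x, ‖z x‖ ^ 2 + a x ^ 2 + b x ^ 2 = 1) (hz : Continuous z) (ha : Continuous a)
    (hb : Continuous b) : Continuous fun x => mk (z x) (a x) (b x) (h x) := by
  refine Continuous.subtype_mk ?_ _
  fun_prop

theorem exists_degree (g : C({y : S3 // 0 ≤ y.1 3 ∧ planar y ≠ 0}, Circle)) :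
    ∃ (k : ℤ) (c : C({y : S3 // 0 ≤ y.1 3 ∧ planar y ≠ 0}, ℝ)),
      ∀ y, g y = phase (planar y.1) ^ k * Circle.exp (c y) := by
  let s : Set ℂ := {z | 0 ≤ z.im} ∩ Metric.ball 0 1
  have hs : Convex ℝ s := (convex_halfSpace_im_ge 0).inter (convex_ball _ _)
  have hne : s.Nonempty := ⟨0, by simp, by simp⟩
  let θ : C({y : S3 // 0 ≤ y.1 3 ∧ planar y ≠ 0}, Circle) :=
    ⟨fun y => phase (planar y.1),
      continuousOn_phase.comp_continuous (by fun_prop) fun x => x.2.2⟩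
  have hz : ∀ z : s, 0 < 1 - ‖z.1‖ ^ 2 := fun z => by
    have h1 : ‖z.1‖ < 1 := by simpa using z.2.2
    nlinarith [norm_nonneg z.1]
  have hmk : ∀ p : s × Circle, ‖(Real.sqrt (1 - ‖p.1.1‖ ^ 2) : ℂ) * p.2‖ ^ 2 + p.1.1.re ^ 2 +
      p.1.1.im ^ 2 = 1 := by
    intro p
    rw [norm_mul, Circle.norm_coe, mul_one, Complex.norm_real, Real.norm_eq_abs, sq_abs,
      Real.sq_sqrt (hz p.1).le, ← Complex.normSq_eq_norm_sq, Complex.normSq_apply]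
    ring
  let E : C(s × Circle, {y : S3 // 0 ≤ y.1 3 ∧ planar y ≠ 0}) :=
    ⟨fun p => ⟨mk _ _ _ (hmk p), by
      refine ⟨by rw [mk_three]; exact p.1.2.1, ?_⟩
      rw [planar_mk]
      exact mul_ne_zero (Complex.ofReal_ne_zero.2 (Real.sqrt_pos.2 (hz p.1)).ne')
        p.2.coe_ne_zero⟩,
      by
        refine Continuous.subtype_mk ?_ _
        exact continuous_mk _ (by fun_prop) (by fun_prop) (by fun_prop)⟩
  have hns : ∀ y : S3, ‖(⟨y.1 2, y.1 3⟩ : ℂ)‖ ^ 2 = 1 - ‖planar y‖ ^ 2 := by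
    intro y
    have := norm_sq_planar_add y
    rw [← Complex.normSq_eq_norm_sq, Complex.normSq_apply]
    simp only
    linarith
  let π : C({y : S3 // 0 ≤ y.1 3 ∧ planar y ≠ 0}, s) :=
    ⟨fun y => ⟨⟨y.1.1 2, y.1.1 3⟩, y.2.1, by
      have h := norm_pos_iff.2 y.2.2
      rw [mem_ball_zero_iff, ← sq_lt_sq₀ (norm_nonneg _) zero_le_one, hns]
      nlinarith⟩, by
      refine Continuous.subtype_mk ?_ _
      have : (fun y : {y : S3 // 0 ≤ y.1 3 ∧ planar y ≠ 0} => (⟨y.1.1 2, y.1.1 3⟩ : ℂ)) =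
          fun y => (y.1.1 2 : ℂ) + (y.1.1 3 : ℂ) * Complex.I := by
        ext y
        exact Complex.mk_eq_add_mul_I _ _
      rw [this]
      fun_prop⟩
  refine exists_degree_of_retract hs hne θ π E (fun y => Subtype.ext ?_) g
  refine ext' ?_ ?_ ?_
  · change planar (mk _ _ _ (hmk (π y, θ y))) = _
    rw [planar_mk]
    change ((Real.sqrt (1 - ‖(⟨y.1.1 2, y.1.1 3⟩ : ℂ)‖ ^ 2) : ℝ) : ℂ) * phase (planar y.1) = _
    rw [hns, sub_sub_cancel, Real.sqrt_sq (norm_nonneg _), norm_mul_phase]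
  · change (mk _ _ _ (hmk (π y, θ y))).1 2 = _
    rw [mk_two]
    rfl
  · change (mk _ _ _ (hmk (π y, θ y))).1 3 = _
    rw [mk_three]
    rfl

end S3

/-! ### A circle-valued map of degree one on the complement of a knot -/

theorem exists_axis_point_notMem {A : Set S3} (hA : A.Finite) :
    ∃ p : S3, S3.planar p = 0 ∧ 0 < p.1 3 ∧ p ∉ A := by
  have hmk : ∀ t : ℝ, ‖(0 : ℂ)‖ ^ 2 + Real.sin t ^ 2 + Real.cos t ^ 2 = 1 := fun t => by
    rw [norm_zero, zero_pow two_ne_zero, zero_add, Real.sin_sq_add_cos_sq]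
  have hI : (Ioo 0 (Real.pi / 2)).Infinite := Ioo_infinite (by positivity)
  have hinj : InjOn (fun t => S3.mk 0 (Real.sin t) (Real.cos t) (hmk t)) (Ioo 0 (Real.pi / 2)) := by
    intro s hs t ht hst
    have h3 := congrArg (fun y : S3 => y.1 3) hst
    simp only [S3.mk_three] at h3
    refine Real.injOn_cos ⟨hs.1.le, ?_⟩ ⟨ht.1.le, ?_⟩ h3
    · linarith [hs.2, Real.pi_pos]
    · linarith [ht.2, Real.pi_pos]
  obtain ⟨p, ⟨t, ht, rfl⟩, hp⟩ := (hI.image hinj).exists_notMem_finite hA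
  refine ⟨_, S3.planar_mk _, ?_, hp⟩
  rw [S3.mk_three]
  exact Real.cos_pos_of_mem_Ioo ⟨by linarith [ht.1, Real.pi_pos], ht.2⟩

/-- The complement of `J` has a map to the circle that differs on the upper ball from the angle
around the great circle only by the exponential of a real function. -/
theorem exists_phase_mul_exp_of_tame {n : ℕ} {P : Polygon E3 n} (hP : IsSimplePolygon P)
    (h : OnePoint E3 ≃ₜ S3) {J : Set S3}
    (hJ : J = h '' ((fun x : E3 => (x : OnePoint E3)) '' P.boundary ℝ))
    (hJC : J ∩ upperBall = greatCircle ∩ upperBall) :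
    ∃ (G : C((Jᶜ : Set S3), Circle)) (c : C({y : S3 // 0 ≤ y.1 3 ∧ S3.planar y ≠ 0}, ℝ)),
      ∀ (y : {y : S3 // 0 ≤ y.1 3 ∧ S3.planar y ≠ 0}) (hy : y.1 ∈ Jᶜ),
        G ⟨y.1, hy⟩ = phase (S3.planar y.1) * Circle.exp (c y) := by
  have hJup : ∀ y : S3, 0 ≤ y.1 3 → (y ∈ J ↔ S3.planar y = 0) := by
    intro y hy
    have : y ∈ J ∩ upperBall ↔ y ∈ greatCircle ∩ upperBall := by rw [hJC]
    rw [← S3.mem_greatCircle]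
    exact ⟨fun h => (this.1 ⟨h, hy⟩).1, fun h => (this.2 ⟨h, hy⟩).1⟩
  obtain ⟨p, hp0, hp3, hpA⟩ := exists_axis_point_notMem
    (A := (fun x : E3 => h x) '' range P.vertices) ((finite_range _).image _)
  have hpJ : p ∈ J := (hJup p hp3.le).2 hp0
  have hpJ' := hpJ
  rw [hJ] at hpJ'
  obtain ⟨_, ⟨q, hq, rfl⟩, hqp⟩ := hpJ'
  simp only at hqp
  have hqv : q ∉ range P.vertices := fun hv => hpA ⟨q, hv, hqp⟩
  obtain ⟨e, G₀, U, c, hG₀, hU, hc, hUb, hUc⟩ := hP.exists_phase hq hqv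
  have hmemJ : ∀ x : OnePoint E3, h x ∈ J ↔
      x ∈ (fun x : E3 => (x : OnePoint E3)) '' P.boundary ℝ := by
    intro x; rw [hJ]; exact h.injective.mem_set_image
  have hmemJ' : ∀ x : E3, h x ∈ J ↔ x ∈ P.boundary ℝ := by
    intro x
    rw [hmemJ]; exact OnePoint.coe_injective.mem_set_image
  let G : C((Jᶜ : Set S3), Circle) := ⟨fun y => G₀ (h.symm y), by
    refine hG₀.comp_continuous (by fun_prop) fun y hy => y.2 ?_
    rw [← h.apply_symm_apply y.1]
    exact (hmemJ _).2 hy⟩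
  have hGh : ∀ (x : E3) (hx : h x ∈ Jᶜ), G ⟨h x, hx⟩ = G₀ x := fun x hx => by
    change G₀ (h.symm (h x)) = G₀ x
    rw [h.symm_apply_apply]
  -- A ball around `q` will be taken inside `U` and inside the preimage of the open upper ball.
  have hcoe : Continuous fun x : E3 => h x := h.continuous.comp OnePoint.continuous_coe
  have hup : {x : E3 | 0 < (h x).1 3} ∈ 𝓝 q := by
    have hc3 : Continuous fun y : S3 => y.1 3 := by fun_prop
    have hq3 : 0 < (h q).1 3 := by rw [hqp]; exact hp3
    exact (isOpen_lt continuous_const (hc3.comp hcoe)).mem_nhds hq3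
  obtain ⟨ε, hε, hball⟩ := Metric.mem_nhds_iff.1 (inter_mem hU hup)
  -- restriction of `G` to the upper ball
  have hXJ : ∀ y : {y : S3 // 0 ≤ y.1 3 ∧ S3.planar y ≠ 0}, y.1 ∈ Jᶜ := fun y hy =>
    y.2.2 ((hJup _ y.2.1).1 hy)
  let g : C({y : S3 // 0 ≤ y.1 3 ∧ S3.planar y ≠ 0}, Circle) :=
    ⟨fun y => G ⟨y.1, hXJ y⟩, G.continuous.comp (continuous_subtype_val.subtype_mk hXJ)⟩
  obtain ⟨k, c₁, hk⟩ := S3.exists_degree g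
  let X := {x : E3 // x ∈ Metric.ball q ε ∧ e.planar (x - q) ≠ 0}
  have hXup : ∀ x : X, 0 ≤ (h x.1).1 3 ∧ S3.planar (h x.1) ≠ 0 := fun x => by
    have h1 := hball x.2.1
    have h3 : 0 < (h x.1).1 3 := h1.2
    refine ⟨h3.le, fun h0 => x.2.2 ?_⟩
    rw [← hUb _ h1.1, ← hmemJ']
    exact (hJup _ h3.le).2 h0
  let j : C(X, {y : S3 // 0 ≤ y.1 3 ∧ S3.planar y ≠ 0}) :=
    ⟨fun x => ⟨h x.1, hXup x⟩, (hcoe.comp continuous_subtype_val).subtype_mk hXup⟩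
  let θ : C(X, Circle) := ⟨fun x => phase (S3.planar (j x).1),
    continuousOn_phase.comp_continuous
      (S3.continuous_planar.comp (continuous_subtype_val.comp j.continuous)) fun x => (j x).2.2⟩
  obtain ⟨l, c₂, hl⟩ := e.exists_degree q hε θ
  let c' : C(X, ℝ) := ⟨fun x => c x.1,
    hc.comp_continuous continuous_subtype_val fun x => (hball x.2.1).1⟩
  -- Around the edge, `G` has degree `-1`, but also degree `k * l`, since it has degree `k` in terms
  -- of the angle around the great circle.
  have key : k * l + 1 = 0 := by
    refine e.eq_zero_of_phase_zpow_eq_exp q hε (c' - (k : ℝ) • c₂ - c₁.comp j) fun x => ?_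
    have e1 : G ⟨h x.1, hXJ (j x)⟩ = phase (S3.planar (j x).1) ^ k * Circle.exp (c₁ (j x)) :=
      hk (j x)
    have e2 : phase (S3.planar (j x).1) = phase (e.planar (x.1 - q)) ^ l * Circle.exp (c₂ x) := hl x
    rw [hGh, hUc _ (hball x.2.1).1 x.2.2, e2, mul_zpow, ← zpow_mul, ← Circle.exp_intCast_mul] at e1
    have e3 : (c' - (k : ℝ) • c₂ - c₁.comp j) x = c x.1 - k * c₂ x - c₁ (j x) := rfl
    rw [e3, Circle.exp_sub, Circle.exp_sub, zpow_add, zpow_one, mul_comm k l]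
    generalize phase (e.planar (x.1 - q)) ^ (l * k) = a at *
    generalize phase (e.planar (x.1 - q)) = f at *
    rw [inv_mul_eq_iff_eq_mul] at e1
    rw [e1, div_div, eq_div_iff_mul_eq', ← mul_assoc, ← mul_assoc, ← mul_assoc, mul_comm f a]
  have hkk : k * k = 1 := by
    have hu : IsUnit k := IsUnit.of_mul_eq_one (-l) (by linarith)
    rcases Int.isUnit_iff.1 hu with rfl | rfl <;> norm_num
  refine ⟨G ^ k, (k : ℝ) • c₁, fun y hy => ?_⟩
  have e1 : G ⟨y.1, hy⟩ = phase (S3.planar y.1) ^ k * Circle.exp (c₁ y) := hk y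
  have e2 : ((k : ℝ) • c₁) y = k * c₁ y := rfl
  rw [ContinuousMap.zpow_apply, e1, mul_zpow, ← zpow_mul, hkk, zpow_one, e2, Circle.exp_intCast_mul]

/-- The complement of `J` has a map to the circle that agrees on the upper ball with the angle
around the great circle. -/
theorem exists_phase_of_tame {n : ℕ} {P : Polygon E3 n} (hP : IsSimplePolygon P)
    (h : OnePoint E3 ≃ₜ S3) {J : Set S3}
    (hJ : J = h '' ((fun x : E3 => (x : OnePoint E3)) '' P.boundary ℝ))
    (hJC : J ∩ upperBall = greatCircle ∩ upperBall) :
    ∃ G : C((Jᶜ : Set S3), Circle), ∀ y : (Jᶜ : Set S3), 0 ≤ y.1.1 3 →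
      G y = phase (S3.planar y) := by
  obtain ⟨G, c, hG⟩ := exists_phase_mul_exp_of_tame hP h hJ hJC
  let s : Set (Jᶜ : Set S3) := {y | 0 ≤ y.1.1 3}
  have hs : IsClosed s := isClosed_le continuous_const (by fun_prop)
  have hpl : ∀ y : s, 0 ≤ y.1.1.1 3 ∧ S3.planar y.1.1 ≠ 0 := fun y => ⟨y.2, fun h0 => y.1.2 (by
    have : y.1.1 ∈ greatCircle ∩ upperBall := ⟨S3.mem_greatCircle.2 h0, y.2⟩
    rw [← hJC] at this
    exact this.1)⟩
  obtain ⟨c', hc'⟩ := ContinuousMap.exists_restrict_eq hs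
    (⟨fun y : s => c ⟨y.1.1, hpl y⟩, by fun_prop⟩ : C(s, ℝ))
  refine ⟨G * Circle.exp.comp (-c'), fun y hy => ?_⟩
  have e1 := hG ⟨y.1, hpl ⟨y, hy⟩⟩ y.2
  have e2 : c' y = c ⟨y.1, hpl ⟨y, hy⟩⟩ := congrArg (fun f : C(s, ℝ) => f ⟨y, hy⟩) hc'
  rw [ContinuousMap.mul_apply, ContinuousMap.comp_apply, ContinuousMap.neg_apply, e2,
    Circle.exp_neg]
  exact mul_inv_eq_of_eq_mul e1

/-! ### Collapsing one summand -/

theorem notMem_of_lower {J : Set S3} (hJ : J ∩ lowerBall = greatCircle ∩ lowerBall) {y : S3}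
    (h3 : y.1 3 ≤ 0) (hy : S3.planar y ≠ 0) : y ∉ J := fun h => by
  have : y ∈ greatCircle ∩ lowerBall := hJ ▸ ⟨h, h3⟩
  exact hy (S3.mem_greatCircle.1 this.1)

theorem planar_ne_zero_of_lower {J : Set S3} (hJ : J ∩ lowerBall = greatCircle ∩ lowerBall) {y : S3}
    (h3 : y.1 3 ≤ 0) (hy : y ∉ J) : S3.planar y ≠ 0 := fun h => by
  have : y ∈ J ∩ lowerBall := hJ ▸ ⟨S3.mem_greatCircle.2 h, h3⟩
  exact hy this.1

theorem notMem_of_upper {J : Set S3} (hJ : J ∩ upperBall = greatCircle ∩ upperBall) {y : S3}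
    (h3 : 0 ≤ y.1 3) (hy : S3.planar y ≠ 0) : y ∉ J := fun h => by
  have : y ∈ greatCircle ∩ upperBall := hJ ▸ ⟨h, h3⟩
  exact hy (S3.mem_greatCircle.1 this.1)

/-- The last coordinate of `y`, scaled by `1 - t` on the lower ball and unchanged on the upper
ball if `0 ≤ t ≤ 1`. -/
def pushHeight (t : ℝ) (y : S3) : ℝ := max (y.1 3) ((1 - t) * y.1 3)

/-- The norm of the vector that results from `y` when its last coordinate becomes
`pushHeight t y`. -/
noncomputable def pushNorm (t : ℝ) (y : S3) : ℝ :=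
  Real.sqrt (‖S3.planar y‖ ^ 2 + y.1 2 ^ 2 + pushHeight t y ^ 2)

theorem pushHeight_of_nonneg {t : ℝ} (ht : t ∈ I) {y : S3} (hy : 0 ≤ y.1 3) :
    pushHeight t y = y.1 3 :=
  max_eq_left (mul_le_of_le_one_left hy (by linarith [ht.1]))

theorem pushHeight_of_nonpos {t : ℝ} (ht : t ∈ I) {y : S3} (hy : y.1 3 ≤ 0) :
    pushHeight t y = (1 - t) * y.1 3 := by
  refine max_eq_right ?_
  nlinarith [mul_nonneg ht.1 (neg_nonneg.2 hy)]

theorem pushNorm_of_nonneg {t : ℝ} (ht : t ∈ I) {y : S3} (hy : 0 ≤ y.1 3) : pushNorm t y = 1 := by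
  rw [pushNorm, pushHeight_of_nonneg ht hy, S3.norm_sq_planar_add, Real.sqrt_one]

theorem pushNorm_pos {J : Set S3} (hJ : J ∩ lowerBall = greatCircle ∩ lowerBall) {t : ℝ}
    (ht : t ∈ I) {y : S3} (hy : y ∉ J) : 0 < pushNorm t y := by
  rcases le_total 0 (y.1 3) with h | h
  · rw [pushNorm_of_nonneg ht h]; exact one_pos
  · have := norm_pos_iff.2 (planar_ne_zero_of_lower hJ h hy)
    exact Real.sqrt_pos.2 (by positivity)

theorem push_norm_sq {t : ℝ} {y : S3} (h : 0 < pushNorm t y) :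
    ‖S3.planar y / pushNorm t y‖ ^ 2 + (y.1 2 / pushNorm t y) ^ 2 +
      (pushHeight t y / pushNorm t y) ^ 2 = 1 := by
  have h2 : pushNorm t y ^ 2 = ‖S3.planar y‖ ^ 2 + y.1 2 ^ 2 + pushHeight t y ^ 2 :=
    Real.sq_sqrt (by positivity)
  rw [norm_div, Complex.norm_real, Real.norm_eq_abs, abs_of_pos h, div_pow, div_pow, div_pow,
    ← add_div, ← add_div, ← h2, div_self (by positivity)]

/-- The point `y`, pushed radially towards the upper ball: the last coordinate becomes
`pushHeight t y`, and the result is normalised. -/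
noncomputable def push (t : ℝ) (y : S3) (h : 0 < pushNorm t y) : S3 :=
  S3.mk (S3.planar y / pushNorm t y) (y.1 2 / pushNorm t y) (pushHeight t y / pushNorm t y)
    (push_norm_sq h)

theorem push_of_nonneg {t : ℝ} (ht : t ∈ I) {y : S3} (hy : 0 ≤ y.1 3) (h : 0 < pushNorm t y) :
    push t y h = y := by
  refine S3.ext' ?_ ?_ ?_
  · rw [push, S3.planar_mk, pushNorm_of_nonneg ht hy]; simp
  · rw [push, S3.mk_two, pushNorm_of_nonneg ht hy, div_one]
  · rw [push, S3.mk_three, pushNorm_of_nonneg ht hy, pushHeight_of_nonneg ht hy, div_one]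

theorem push_zero {y : S3} (h : 0 < pushNorm 0 y) : push 0 y h = y := by
  have hl : pushHeight 0 y = y.1 3 := by simp [pushHeight]
  have hn : pushNorm 0 y = 1 := by rw [pushNorm, hl, S3.norm_sq_planar_add, Real.sqrt_one]
  refine S3.ext' ?_ ?_ ?_
  · rw [push, S3.planar_mk, hn]; simp
  · rw [push, S3.mk_two, hn, div_one]
  · rw [push, S3.mk_three, hn, hl, div_one]

theorem planar_push_ne_zero {t : ℝ} {y : S3} (h : 0 < pushNorm t y) (hy : S3.planar y ≠ 0) :
    S3.planar (push t y h) ≠ 0 := by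
  rw [push, S3.planar_mk]
  exact div_ne_zero hy (Complex.ofReal_ne_zero.2 h.ne')

theorem push_notMem {J : Set S3} (hJ : J ∩ lowerBall = greatCircle ∩ lowerBall) {t : ℝ}
    (ht : t ∈ I) {y : S3} (hy : y ∉ J) (h : 0 < pushNorm t y) : push t y h ∉ J := by
  rcases le_total 0 (y.1 3) with h3 | h3
  · rwa [push_of_nonneg ht h3]
  · refine notMem_of_lower hJ ?_ (planar_push_ne_zero h (planar_ne_zero_of_lower hJ h3 hy))
    rw [push, S3.mk_three, pushHeight_of_nonpos ht h3]
    exact div_nonpos_of_nonpos_of_nonneg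
      (mul_nonpos_of_nonneg_of_nonpos (by linarith [ht.2]) h3) h.le

theorem push_one_three_nonneg {y : S3} (h : 0 < pushNorm 1 y) : 0 ≤ (push 1 y h).1 3 := by
  rw [push, S3.mk_three]
  refine div_nonneg ?_ h.le
  simp [pushHeight]

theorem push_one_planar_ne_zero {J : Set S3} (hJ : J ∩ lowerBall = greatCircle ∩ lowerBall)
    {y : S3} (hy : y ∉ J) (h : 0 < pushNorm 1 y) (h3 : (push 1 y h).1 3 ≤ 0) :
    S3.planar (push 1 y h) ≠ 0 :=
  planar_ne_zero_of_lower hJ h3 (push_notMem hJ ⟨zero_le_one, le_rfl⟩ hy h)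

theorem continuous_push {X : Type*} [TopologicalSpace X] {t : X → ℝ} {y : X → S3}
    (ht : Continuous t) (hy : Continuous y) (h : ∀ x, 0 < pushNorm (t x) (y x)) :
    Continuous fun x => push (t x) (y x) (h x) := by
  have hy' : ∀ i, Continuous fun x => (y x).1 i := fun i => by fun_prop
  have hl : Continuous fun x => pushHeight (t x) (y x) := by
    unfold pushHeight
    exact (hy' 3).max ((continuous_const.sub ht).mul (hy' 3))
  have hp : Continuous fun x => S3.planar (y x) := S3.continuous_planar.comp hy
  have hn : Continuous fun x => pushNorm (t x) (y x) := by
    unfold pushNorm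
    exact (((hp.norm.pow 2).add ((hy' 2).pow 2)).add (hl.pow 2)).sqrt
  unfold push
  exact S3.continuous_mk _
    (hp.div (Complex.continuous_ofReal.comp hn) fun x => Complex.ofReal_ne_zero.2 (h x).ne')
    ((hy' 2).div hn fun x => (h x).ne') (hl.div hn fun x => (h x).ne')

theorem equator_norm_sq (u : Circle) (y : S3) :
    ‖((Real.sqrt (1 - y.1 2 ^ 2) : ℝ) : ℂ) * u‖ ^ 2 + y.1 2 ^ 2 + (0 : ℝ) ^ 2 = 1 := by
  rw [norm_mul, Circle.norm_coe, mul_one, Complex.norm_real, Real.norm_eq_abs, sq_abs,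
    Real.sq_sqrt (sub_nonneg.2 (S3.sq_le_one y))]
  ring

/-- The point of the equatorial two-sphere with phase `u` and the same third coordinate as `y`. -/
noncomputable def equator (u : Circle) (y : S3) : S3 := S3.mk _ _ _ (equator_norm_sq u y)

theorem continuous_equator : Continuous fun p : Circle × S3 => equator p.1 p.2 := by
  have h2 : Continuous fun y : S3 => y.1 2 := by fun_prop
  refine S3.continuous_mk _ ?_ (h2.comp continuous_snd) continuous_const
  exact (Complex.continuous_ofReal.comp
    ((continuous_const.sub (h2.pow 2)).sqrt.comp continuous_snd)).mul
    (continuous_subtype_val.comp continuous_fst)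

theorem continuousOn_equator {Z : Type*} [TopologicalSpace Z] {u : Z → Circle} {y : Z → S3}
    {s : Set Z} (hu : ContinuousOn u s) (hy : ContinuousOn y s) :
    ContinuousOn (fun z => equator (u z) (y z)) s :=
  Continuous.comp_continuousOn (g := fun p : Circle × S3 => equator p.1 p.2)
    (f := fun z => (u z, y z)) continuous_equator (hu.prodMk hy)

/-- The complement of the connected sum maps to the complement of the first summand, by the identity
on the upper ball. -/
theorem exists_collapse {J₁ J₂ : Set S3} (h₁ : J₁ ∩ lowerBall = greatCircle ∩ lowerBall)
    (G : C((J₂ᶜ : Set S3), Circle))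
    (hG : ∀ y : (J₂ᶜ : Set S3), 0 ≤ y.1.1 3 → G y = phase (S3.planar y)) :
    ∃ f : C((((J₁ ∩ upperBall) ∪ (J₂ ∩ lowerBall))ᶜ : Set S3), (J₁ᶜ : Set S3)),
      ∀ y, 0 ≤ y.1.1 3 → (f y).1 = y.1 := by
  classical
  set K := (J₁ ∩ upperBall) ∪ (J₂ ∩ lowerBall)
  let g : S3 → Circle := fun y => if h : y ∈ J₂ᶜ then G ⟨y, h⟩ else 1
  have hg : ∀ y (h : y ∈ J₂ᶜ), g y = G ⟨y, h⟩ := fun y h => dif_pos h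
  have hgc : ContinuousOn g J₂ᶜ := by
    rw [continuousOn_iff_continuous_domRestrict]
    convert! G.continuous using 1
    ext y
    rw [domRestrict_apply, hg y y.2]
  have hu : ∀ y : (Kᶜ : Set S3), 0 ≤ y.1.1 3 → y.1 ∉ J₁ := fun y h hy => y.2 (Or.inl ⟨hy, h⟩)
  have hl : ∀ y : (Kᶜ : Set S3), y.1.1 3 ≤ 0 → y.1 ∉ J₂ := fun y h hy => y.2 (Or.inr ⟨hy, h⟩)
  let b : (Kᶜ : Set S3) → S3 := fun y => equator (g y.1) y.1
  let F : (Kᶜ : Set S3) → S3 := fun y => if 0 ≤ y.1.1 3 then y.1 else b y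
  have hy3 : ∀ i, Continuous fun y : (Kᶜ : Set S3) => y.1.1 i := fun i => by fun_prop
  have hgK : ContinuousOn (fun y : (Kᶜ : Set S3) => g y.1) {y | y.1.1 3 ≤ 0} :=
    hgc.comp continuous_subtype_val.continuousOn fun y hy => hl y hy
  have hF : Continuous F := by
    have hb : ContinuousOn b {y | y.1.1 3 ≤ 0} :=
      continuousOn_equator hgK continuous_subtype_val.continuousOn
    refine continuous_if_le continuous_const (hy3 3) continuous_subtype_val.continuousOn hb ?_
    · intro y hy
      have hyJ := hl y hy.ge
      refine S3.ext' ?_ ?_ ?_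
      · change _ = S3.planar (equator (g y.1) y.1)
        rw [equator, S3.planar_mk, hg _ hyJ, hG _ hy.le]
        have := S3.norm_sq_planar_add y.1
        rw [← hy] at this
        have h1 : 1 - y.1.1 2 ^ 2 = ‖S3.planar y.1‖ ^ 2 := by linarith
        rw [h1, Real.sqrt_sq (norm_nonneg _), norm_mul_phase]
      · exact (S3.mk_two _).symm
      · exact hy.symm.trans (S3.mk_three _).symm
  have hFJ : ∀ y, F y ∈ J₁ᶜ := by
    intro y
    by_cases h : 0 ≤ y.1.1 3
    · simp only [F, if_pos h]; exact hu y h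
    · simp only [F, if_neg h]
      refine notMem_of_lower h₁ (S3.mk_three _).le ?_
      change S3.planar (equator (g y.1) y.1) ≠ 0
      rw [equator, S3.planar_mk]
      refine mul_ne_zero (Complex.ofReal_ne_zero.2 (Real.sqrt_pos.2 ?_).ne') (g y.1).coe_ne_zero
      have h3 : 0 < y.1.1 3 ^ 2 := by
        exact sq_pos_of_neg (not_le.1 h)
      nlinarith [S3.norm_sq_planar_add y.1, sq_nonneg ‖S3.planar y.1‖]
  exact ⟨⟨fun y => ⟨F y, hFJ y⟩, hF.subtype_mk hFJ⟩, fun y hy => if_pos hy⟩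

/-- A map as in `exists_collapse` has a section up to homotopy, which pushes the complement of the
standard arc in the lower ball onto the equator. -/
theorem exists_homotopic_section {J₁ J₂ : Set S3} (h₁ : J₁ ∩ lowerBall = greatCircle ∩ lowerBall)
    (h₂ : J₂ ∩ upperBall = greatCircle ∩ upperBall)
    (f : C((((J₁ ∩ upperBall) ∪ (J₂ ∩ lowerBall))ᶜ : Set S3), (J₁ᶜ : Set S3)))
    (hf : ∀ y, 0 ≤ y.1.1 3 → (f y).1 = y.1) :
    ∃ r : C((J₁ᶜ : Set S3), (((J₁ ∩ upperBall) ∪ (J₂ ∩ lowerBall))ᶜ : Set S3)),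
      (f.comp r).Homotopic (ContinuousMap.id _) := by
  have h1I : (1 : ℝ) ∈ I := ⟨zero_le_one, le_rfl⟩
  have hpos : ∀ (t : I) (y : (J₁ᶜ : Set S3)), 0 < pushNorm t y.1 :=
    fun t y => pushNorm_pos h₁ t.2 y.2
  have hK : ∀ y : (J₁ᶜ : Set S3), push 1 y.1 (hpos 1 y) ∈
      ((J₁ ∩ upperBall) ∪ (J₂ ∩ lowerBall))ᶜ := by
    rintro y (⟨h, -⟩ | ⟨h, h3⟩)
    · exact push_notMem h₁ h1I y.2 _ h
    · exact notMem_of_upper h₂ (push_one_three_nonneg _)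
        (push_one_planar_ne_zero h₁ y.2 _ h3) h
  let r : C((J₁ᶜ : Set S3), (((J₁ ∩ upperBall) ∪ (J₂ ∩ lowerBall))ᶜ : Set S3)) :=
    ⟨fun y => ⟨push 1 y.1 (hpos 1 y), hK y⟩,
      (continuous_push continuous_const continuous_subtype_val _).subtype_mk hK⟩
  have hH : ∀ p : I × (J₁ᶜ : Set S3), push p.1 p.2.1 (hpos p.1 p.2) ∈ J₁ᶜ := fun p =>
    push_notMem h₁ p.1.2 p.2.2 _
  refine ⟨r, ContinuousMap.Homotopic.symm ⟨⟨⟨fun p => ⟨push p.1 p.2.1 (hpos p.1 p.2), hH p⟩,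
    (continuous_push (continuous_subtype_val.comp continuous_fst)
      (continuous_subtype_val.comp continuous_snd) _).subtype_mk hH⟩, ?_, ?_⟩⟩⟩
  · intro y
    exact Subtype.ext (push_zero (hpos 0 y))
  · intro y
    exact Subtype.ext (hf (r y) (push_one_three_nonneg (hpos 1 y))).symm

/-! ### The rank of a fundamental group -/

theorem minGenerators_le_of_surjective {G H : Type} [Group G] [Group H] (φ : G →* H)
    (hφ : Function.Surjective φ) : minGenerators H ≤ minGenerators G := by
  have : Nonempty {S : Set G // Subgroup.closure S = ⊤} :=
    ⟨⟨univ, Subgroup.closure_univ⟩⟩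
  refine le_ciInf fun S => ?_
  have hS : Subgroup.closure (φ '' S.1) = ⊤ := by
    rw [← MonoidHom.map_closure, S.2, ← MonoidHom.range_eq_map, MonoidHom.range_eq_top.2 hφ]
  exact (ciInf_le' _ (⟨φ '' S.1, hS⟩ : {S : Set H // Subgroup.closure S = ⊤})).trans
    Cardinal.mk_image_le

open CategoryTheory in
theorem FundamentalGroup.map_surjective_of_homotopic {X Y : Type} [TopologicalSpace X]
    [TopologicalSpace Y] (f : C(X, Y)) (r : C(Y, X))
    (h : (f.comp r).Homotopic (ContinuousMap.id Y)) (y : Y) :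
    Function.Surjective (FundamentalGroup.map f (r y)) := by
  obtain ⟨H⟩ := h
  have hfull : (FundamentalGroupoid.map (f.comp r)).Full := by
    have hid : (FundamentalGroupoid.map (ContinuousMap.id Y)).Full := by
      rw [FundamentalGroupoid.map_id]; infer_instance
    exact Functor.Full.of_iso (asIso (FundamentalGroupoidFunctor.homotopicMapsNatIso H)).symm
  rw [FundamentalGroupoid.map_comp] at hfull
  intro γ
  obtain ⟨δ, hδ⟩ := hfull.map_surjective (X := ⟨y⟩) (Y := ⟨y⟩) γ
  exact ⟨(FundamentalGroupoid.map r).map δ, hδ⟩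

theorem minGenerators_fundamentalGroup_le {X Y : Type} [TopologicalSpace X] [TopologicalSpace Y]
    [PathConnectedSpace X] [PathConnectedSpace Y] (f : C(X, Y)) (r : C(Y, X))
    (h : (f.comp r).Homotopic (ContinuousMap.id Y)) (x : X) (y : Y) :
    minGenerators (FundamentalGroup Y y) ≤ minGenerators (FundamentalGroup X x) := by
  let a := FundamentalGroup.fundamentalGroupMulEquivOfPathConnected x (r y)
  let b := FundamentalGroup.fundamentalGroupMulEquivOfPathConnected (f (r y)) y
  refine minGenerators_le_of_surjective
    ((b.toMonoidHom.comp (FundamentalGroup.map f (r y))).comp a.toMonoidHom) ?_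
  exact (b.surjective.comp (FundamentalGroup.map_surjective_of_homotopic f r h y)).comp a.surjective

/-! ### Path-connectedness of knot complements -/

theorem volume_affineSpan_triple (x a b : E3) :
    MeasureTheory.volume (affineSpan ℝ {x, a, b} : Set E3) = 0 := by
  refine MeasureTheory.Measure.addHaar_affineSubspace _ _ fun htop => ?_
  have h1 : Module.finrank ℝ (vectorSpan ℝ {x, a, b}) ≤ 2 := by
    have := finrank_vectorSpan_range_le ℝ ![x, a, b] (n := 2) (by simp)
    have hr : ({x, a, b} : Set E3) = range ![x, a, b] := by
      ext; simp [Matrix.range_cons]; tauto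
    rwa [hr]
  rw [← direction_affineSpan, htop, AffineSubspace.direction_top, finrank_top] at h1
  simp at h1

/-- The plane through a point `x` off the polygon and any given edge is a null set, so for almost
every `z` the segments from `x` and from a second point to `z` miss the polygon. -/
theorem isPathConnected_compl_boundary {n : ℕ} (P : Polygon E3 n) :
    IsPathConnected (P.boundary ℝ)ᶜ := by
  have hnull : ∀ x : E3, MeasureTheory.volume
      (⋃ i, (affineSpan ℝ {x, P.vertices i, P.vertices (finRotate n i)} : Set E3)) = 0 := fun x =>
    MeasureTheory.measure_iUnion_null fun i => volume_affineSpan_triple _ _ _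
  have hseg : ∀ x ∈ (P.boundary ℝ)ᶜ, ∀ z,
      z ∉ (⋃ i, (affineSpan ℝ {x, P.vertices i, P.vertices (finRotate n i)} : Set E3)) →
      segment ℝ x z ⊆ (P.boundary ℝ)ᶜ := by
    intro x hx z hz w hw hwP
    obtain ⟨i, hi⟩ := mem_iUnion.1 hwP
    apply hz
    refine mem_iUnion.2 ⟨i, ?_⟩
    have hwS : w ∈ affineSpan ℝ {x, P.vertices i, P.vertices (finRotate n i)} := by
      have h1 : w ∈ affineSpan ℝ {P.vertices i, P.vertices (finRotate n i)} := by
        obtain ⟨t, -, rfl⟩ := hi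
        exact AffineMap.lineMap_mem_affineSpan_pair _ _ _
      exact affineSpan_mono ℝ (subset_insert _ _) h1
    have hxS : x ∈ affineSpan ℝ {x, P.vertices i, P.vertices (finRotate n i)} :=
      subset_affineSpan _ _ (mem_insert _ _)
    have hxw : x ≠ w := fun h => hx (h ▸ hwP)
    rw [segment_eq_image_lineMap] at hw
    obtain ⟨t, -, rfl⟩ := hw
    have ht : t ≠ 0 := by
      rintro rfl
      simp at hxw
    have : z = AffineMap.lineMap x (AffineMap.lineMap x z t) t⁻¹ := by
      simp [AffineMap.lineMap_apply, smul_smul, ht]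
    rw [SetLike.mem_coe, this]
    exact AffineMap.lineMap_mem _ hxS hwS
  have hex : ∀ x y : E3, ∃ z,
      z ∉ (⋃ i, (affineSpan ℝ {x, P.vertices i, P.vertices (finRotate n i)} : Set E3)) ∧
      z ∉ (⋃ i, (affineSpan ℝ {y, P.vertices i, P.vertices (finRotate n i)} : Set E3)) := by
    intro x y
    by_contra! hcon
    have : (univ : Set E3) ⊆
        (⋃ i, (affineSpan ℝ {x, P.vertices i, P.vertices (finRotate n i)} : Set E3)) ∪
        (⋃ i, (affineSpan ℝ {y, P.vertices i, P.vertices (finRotate n i)} : Set E3)) := by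
      intro z _
      by_cases h : z ∈ (⋃ i, (affineSpan ℝ {x, P.vertices i, P.vertices (finRotate n i)} : Set E3))
      · exact Or.inl h
      · exact Or.inr (hcon z h)
    have h0 := MeasureTheory.measure_mono_null this
      (MeasureTheory.measure_union_null (hnull x) (hnull y))
    exact (isOpen_univ.measure_ne_zero MeasureTheory.volume univ_nonempty) h0
  rw [isPathConnected_iff]
  constructor
  · by_contra! hcon
    have hb : P.boundary ℝ = univ := by rw [← compl_empty_iff, hcon]
    obtain ⟨z, hz, -⟩ := hex 0 0
    have hzb : z ∈ P.boundary ℝ := hb ▸ mem_univ z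
    obtain ⟨i, t, -, rfl⟩ := mem_iUnion.1 hzb
    exact hz (mem_iUnion.2 ⟨i, affineSpan_mono ℝ (subset_insert _ _)
      (AffineMap.lineMap_mem_affineSpan_pair _ _ _)⟩)
  · intro x hx y hy
    obtain ⟨z, hzx, hzy⟩ := hex x y
    exact (JoinedIn.of_segment_subset (hseg x hx z hzx)).trans
      (JoinedIn.of_segment_subset (hseg y hy z hzy)).symm

theorem isCompact_boundary {n : ℕ} (P : Polygon E3 n) : IsCompact (P.boundary ℝ) := by
  refine isCompact_iUnion fun i => ?_
  rw [Polygon.edgeSet, affineSegment_eq_segment, ← convexHull_pair]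
  exact (Set.toFinite _).isCompact_convexHull (𝕜 := ℝ)

theorem isPathConnected_compl_of_tame {n : ℕ} (P : Polygon E3 n) (h : OnePoint E3 ≃ₜ S3) :
    IsPathConnected (h '' ((fun x : E3 => (x : OnePoint E3)) '' P.boundary ℝ))ᶜ := by
  set Q : Set (OnePoint E3) := (fun x : E3 => (x : OnePoint E3)) '' P.boundary ℝ
  have hQ : IsClosed Q := ((isCompact_boundary P).image OnePoint.continuous_coe).isClosed
  have hconn : IsConnected Qᶜ := by
    have h1 : IsConnected ((fun x : E3 => (x : OnePoint E3)) '' (P.boundary ℝ)ᶜ) :=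
      (isPathConnected_compl_boundary P).isConnected.image _ OnePoint.continuous_coe.continuousOn
    refine h1.subset_closure ?_ ?_
    · rintro _ ⟨x, hx, rfl⟩ ⟨y, hy, hxy⟩
      exact hx (OnePoint.coe_injective hxy ▸ hy)
    · intro x hx
      induction x using OnePoint.rec with
      | coe x => exact subset_closure ⟨x, fun h => hx ⟨x, h, rfl⟩, rfl⟩
      | infty =>
        -- The point at infinity is a limit of points off the polygon.
        refine mem_closure_of_tendsto OnePoint.tendsto_coe_infty ?_
        rw [coclosedCompact_eq_cocompact]
        filter_upwards [(isCompact_boundary P).compl_mem_cocompact] with x hx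
        exact ⟨x, hx, rfl⟩
  have hconn' : IsConnected (h '' Q)ᶜ := by
    rw [← image_compl_eq h.bijective]
    exact hconn.image _ h.continuous.continuousOn
  have : LocallyPathConnectedSpace S3 :=
    ChartedSpace.locallyPathConnectedSpace (EuclideanSpace ℝ (Fin 3)) S3
  have hopen : IsOpen (h '' Q)ᶜ := (h.isClosedMap _ hQ).isOpen_compl
  exact (hopen.isConnected_iff_isPathConnected).1 hconn'

/-! ### The rank of a connected sum -/

theorem Knot.pathConnectedSpace_complement (K : Knot) : PathConnectedSpace K.complement := by
  obtain ⟨n, P, h, -, hK⟩ := K.tame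
  have := isPathConnected_compl_of_tame P h
  rw [← hK] at this
  exact isPathConnected_iff_pathConnectedSpace.1 this

theorem Knot.rank_le_rank_of_image {K K₁ K₂ : Knot} {J₁ J₂ : Set S3} (φ φ₁ φ₂ : S3 ≃ₜ S3)
    (hφ₁ : φ₁ '' K₁.carrier = J₁) (hJ₁ : J₁ ∩ lowerBall = greatCircle ∩ lowerBall)
    (hφ₂ : φ₂ '' K₂.carrier = J₂) (hJ₂ : J₂ ∩ upperBall = greatCircle ∩ upperBall)
    (hφ : φ '' K.carrier = (J₁ ∩ upperBall) ∪ (J₂ ∩ lowerBall))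
    (x : K.complement) (x₁ : K₁.complement) : K₁.rank x₁ ≤ K.rank x := by
  obtain ⟨n, P, h, hP, hK₂⟩ := K₂.tame
  obtain ⟨G, hG⟩ := exists_phase_of_tame hP (h.trans φ₂) (J := J₂)
    (by rw [← hφ₂, hK₂, image_image]; rfl) hJ₂
  obtain ⟨f, hf⟩ := exists_collapse hJ₁ G hG
  obtain ⟨r, hr⟩ := exists_homotopic_section hJ₁ hJ₂ f hf
  have := K.pathConnectedSpace_complement
  have := K₁.pathConnectedSpace_complement
  let ψ : K.complement ≃ₜ (((J₁ ∩ upperBall) ∪ (J₂ ∩ lowerBall))ᶜ : Set S3) :=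
    φ.subtype fun a => by
      rw [← hφ, mem_compl_iff, mem_compl_iff, φ.injective.mem_set_image]
  let ψ₁ : K₁.complement ≃ₜ (J₁ᶜ : Set S3) :=
    φ₁.subtype fun a => by
      rw [← hφ₁, mem_compl_iff, mem_compl_iff, φ₁.injective.mem_set_image]
  let a : C(K.complement, (((J₁ ∩ upperBall) ∪ (J₂ ∩ lowerBall))ᶜ : Set S3)) := ψ
  let a' : C((((J₁ ∩ upperBall) ∪ (J₂ ∩ lowerBall))ᶜ : Set S3), K.complement) := ψ.symm
  let b : C(K₁.complement, (J₁ᶜ : Set S3)) := ψ₁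
  let b' : C((J₁ᶜ : Set S3), K₁.complement) := ψ₁.symm
  refine minGenerators_fundamentalGroup_le ((b'.comp f).comp a) ((a'.comp r).comp b) ?_ x x₁
  have h1 : ((b'.comp (f.comp r)).comp b).Homotopic ((b'.comp (ContinuousMap.id _)).comp b) :=
    ((ContinuousMap.Homotopic.refl b').comp hr).comp (ContinuousMap.Homotopic.refl b)
  have e1 : ((b'.comp f).comp a).comp ((a'.comp r).comp b) = (b'.comp (f.comp r)).comp b := by
    ext1 y
    change b' (f (ψ (ψ.symm (r (b y))))) = b' (f (r (b y)))
    rw [ψ.apply_symm_apply]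
  have e2 : (b'.comp (ContinuousMap.id _)).comp b = ContinuousMap.id _ := by
    ext1 y
    exact ψ₁.symm_apply_apply y
  rwa [e1, ← e2]

theorem S3.norm_sq_planar_add_neg (y : S3) :
    ‖S3.planar y‖ ^ 2 + y.1 2 ^ 2 + (-y.1 3) ^ 2 = 1 := by
  rw [neg_sq]; exact S3.norm_sq_planar_add y

/-- The reflection of the three-sphere that exchanges the two hemispheres. -/
noncomputable def S3.reflect : S3 ≃ₜ S3 :=
  have hinv : Function.Involutive fun y =>
      S3.mk (S3.planar y) (y.1 2) (-y.1 3) (S3.norm_sq_planar_add_neg y) := fun y =>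
    S3.ext' (by simp) (by simp) (by simp)
  have hcont : Continuous fun y =>
      S3.mk (S3.planar y) (y.1 2) (-y.1 3) (S3.norm_sq_planar_add_neg y) :=
    S3.continuous_mk _ S3.continuous_planar (by fun_prop) (by fun_prop)
  { toEquiv := hinv.toPerm
    continuous_toFun := hcont
    continuous_invFun := hcont }

theorem S3.reflect_three (y : S3) : (S3.reflect y).1 3 = -y.1 3 :=
  S3.mk_three (S3.norm_sq_planar_add_neg y)

theorem S3.planar_reflect (y : S3) : S3.planar (S3.reflect y) = S3.planar y :=
  S3.planar_mk (S3.norm_sq_planar_add_neg y)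

theorem S3.reflect_reflect (y : S3) : S3.reflect (S3.reflect y) = y := S3.reflect.symm_apply_apply y

theorem S3.reflect_image (A : Set S3) : S3.reflect '' A = S3.reflect ⁻¹' A :=
  congrFun (image_eq_preimage_of_inverse S3.reflect_reflect S3.reflect_reflect) A

theorem S3.preimage_reflect_lowerBall : S3.reflect ⁻¹' lowerBall = upperBall := by
  ext y
  change (S3.reflect y).1 3 ≤ 0 ↔ 0 ≤ y.1 3
  rw [S3.reflect_three, neg_nonpos]

theorem S3.preimage_reflect_upperBall : S3.reflect ⁻¹' upperBall = lowerBall := by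
  ext y
  change 0 ≤ (S3.reflect y).1 3 ↔ y.1 3 ≤ 0
  rw [S3.reflect_three, neg_nonneg]

theorem S3.preimage_reflect_greatCircle : S3.reflect ⁻¹' greatCircle = greatCircle := by
  ext y
  rw [mem_preimage, S3.mem_greatCircle, S3.mem_greatCircle, S3.planar_reflect]

theorem proposition4p4 (K K₁ K₂ : Knot) (hK : IsConnectedSum K K₁ K₂)
    (x : K.complement) (x₁ : K₁.complement) (x₂ : K₂.complement) :
    max (K₁.rank x₁) (K₂.rank x₂) ≤ K.rank x := by
  obtain ⟨J₁, J₂, ⟨H₁, -, -, hH₁⟩, hJ₁, ⟨H₂, -, -, hH₂⟩, hJ₂, ⟨H, -, -, hH⟩⟩ := hK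
  refine max_le (Knot.rank_le_rank_of_image (H 1) (H₁ 1) (H₂ 1) hH₁ hJ₁ hH₂ hJ₂ hH x x₁) ?_
  have himage : ∀ (φ : S3 ≃ₜ S3) (A B : Set S3), φ '' A = B →
      (φ.trans S3.reflect) '' A = S3.reflect ⁻¹' B := by
    rintro φ A B rfl
    rw [← S3.reflect_image, image_image]
    rfl
  refine Knot.rank_le_rank_of_image ((H 1).trans S3.reflect) ((H₂ 1).trans S3.reflect)
    ((H₁ 1).trans S3.reflect) (himage _ _ _ hH₂) ?_ (himage _ _ _ hH₁) ?_ ?_ x x₂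
  · rw [← S3.preimage_reflect_upperBall, ← preimage_inter, hJ₂, preimage_inter,
      S3.preimage_reflect_greatCircle]
  · rw [← S3.preimage_reflect_lowerBall, ← preimage_inter, hJ₁, preimage_inter,
      S3.preimage_reflect_greatCircle]
  · rw [himage _ _ _ hH, preimage_union, preimage_inter, preimage_inter,
      S3.preimage_reflect_upperBall, S3.preimage_reflect_lowerBall, union_comm]
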